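/- **Notation.** A mixture of $k$ spherical Gaussians in $\mathbb{R}^d$ ($k,d\ge 1$) is given by parameters $\mathcal{G}=\{(w_j,\mu_j,\sigma_j): j\in[k]\}$ with $w_j\ge 0$, $\sum_j w_j=1$, $\mu_j\in\mathbb{R}^d$, $\sigma_j>0$. Its probability density function is $$f(x)=\sum_{j=1}^k w_j\,\sigma_j^{-d}\exp\!\big(-\pi\|x-\mu_j\|_2^2/\sigma_j^2\big),$$ i.e. the $j$th component has weight $w_j$, mean $\mu_j$ and covariance $\frac{\sigma_j^2}{2\pi}I$. Write $w_{\min}=\min_j w_j$ for the minimum weight of $\mathcal{G}$, and denote the parameters, the minimum weight and the density of a second mixture $\mathcal{G}^*$ of $k$ spherical Gaussians in $\mathbb{R}^d$ by $w_j^*,\mu_j^*,\sigma_j^*$, $w^*_{\min}$ and $f^*$. When all weights are positive, the parameter distance of $\mathcal{G}$ and $\mathcal{G}^*$ is $$\Delta_{\mathrm{param}}(\mathcal{G},\mathcal{G}^*)=\min_{\pi\in \mathrm{Perm}_k}\left(\sum_{j=1}^k\frac{|w_j-w^*_{\pi(j)}|}{\min\{w_j,w^*_{\pi(j)}\}}+\sum_{j=1}^k\frac{\|\mu_j-\mu^*_{\pi(j)}\|_2}{\min\{\sigma_j,\sigma^*_{\pi(j)}\}}+\sum_{j=1}^k\frac{|\sigma_j-\sigma^*_{\pi(j)}|}{\min\{\sigma_j,\sigma^*_{\pi(j)}\}}\right),$$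 and we put $$\rho_s=\max\left\{\frac{\max_j\sigma^*_j}{\min_j\sigma_j},\ \frac{\max_j\sigma_j}{\min_j\sigma^*_j}\right\}.$$ **Proposition 5.3.** There is a universal constant $c'>0$ such that the following holds for all integers $d,k\ge1$, every real $c\ge 5$, and any two mixtures $\mathcal{G},\mathcal{G}^*$ of $k$ spherical Gaussians in $\mathbb{R}^d$. If $w_{\min}\ge k^{-c}$ and $w^*_{\min}\ge k^{-c}$, if $$\Delta_{\mathrm{param}}(\mathcal{G},\mathcal{G}^*)\ge \frac{1}{k^{c-1}},$$ and if $\mathcal{G}$ is well-separated in the sense that $$\|\mu_i-\mu_j\|_2\ \ge\ 4c\sqrt{\log(\rho_s/w_{\min})}\,(\sigma_i+\sigma_j)\qquad\text{for all } i\neq j \text{ in } [k],$$ then $$\|f-f^*\|_1=\int_{\mathbb{R}^d}|f(x)-f^*(x)|\,dx\ \ge\ \frac{c'}{d\,k^{2c}\,\rho_s^2}.$$ -/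

import Mathlib

noncomputable section

/-- A mixture of `k` spherical Gaussians in `ℝ^d`, given by its parameters `(w j, μ j, σ j)`:
the `j`-th component has weight `w j`, mean `μ j` and covariance `(σ j ^ 2 / (2 π)) • I`. -/
structure SphericalMixture (k d : ℕ) where
  w : Fin k → ℝ
  μ : Fin k → EuclideanSpace ℝ (Fin d)
  σ : Fin k → ℝ
  w_nonneg : ∀ j, 0 ≤ w j
  w_sum : ∑ j, w j = 1
  σ_pos : ∀ j, 0 < σ j

/-- The density on `ℝ^d` of the spherical Gaussian with mean `m` and covariance
`(s ^ 2 / (2 π)) • I`. -/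
def sphericalGaussianPdf {d : ℕ} (m : EuclideanSpace ℝ (Fin d)) (s : ℝ)
    (x : EuclideanSpace ℝ (Fin d)) : ℝ :=
  (s ^ d)⁻¹ * Real.exp (-(Real.pi * ‖x - m‖ ^ 2 / s ^ 2))

namespace SphericalMixture

variable {k d : ℕ}

/-- The density of the mixture. -/
def pdf (G : SphericalMixture k d) (x : EuclideanSpace ℝ (Fin d)) : ℝ :=
  ∑ j, G.w j * sphericalGaussianPdf (G.μ j) (G.σ j) x

/-- The smallest weight. (The index set is nonempty since the weights sum to `1`.) -/
def wMin (G : SphericalMixture k d) : ℝ := ⨅ j, G.w j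

/-- The smallest `σ j`. -/
def σMin (G : SphericalMixture k d) : ℝ := ⨅ j, G.σ j

/-- The largest `σ j`. -/
def σMax (G : SphericalMixture k d) : ℝ := ⨆ j, G.σ j

/-- The aspect ratio `ρ_s = max (σ*_max / σ_min) (σ_max / σ*_min)` of the two mixtures. -/
def aspectRatio (G G' : SphericalMixture k d) : ℝ :=
  max (G'.σMax / G.σMin) (G.σMax / G'.σMin)

/-- The parameter distance: the minimum over all matchings `π` of the components of the total
relative difference of the weights, of the means and of the standard deviations. -/
def paramDist (G G' : SphericalMixture k d) : ℝ :=
  Finset.univ.inf' Finset.univ_nonempty fun π : Equiv.Perm (Fin k) =>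
    ∑ j, |G.w j - G'.w (π j)| / min (G.w j) (G'.w (π j)) +
      ∑ j, ‖G.μ j - G'.μ (π j)‖ / min (G.σ j) (G'.σ (π j)) +
      ∑ j, |G.σ j - G'.σ (π j)| / min (G.σ j) (G'.σ (π j))

end SphericalMixture

end

/-! Argue by contradiction from a small `L¹` distance. Around each mean of `G` lies a polyhedral
cell that holds almost all of its component, and beyond a layer of width `D` above that cell lie all
the other cells. So `G` hardly charges the layer, and neither does `G'`. By Gaussian isoperimetry
(`stdGaussian_polyhedron_layer`) a component of `G'` that charged both the cell and the far side
would charge the layer; hence, up to weights, each component of `G'` is almost inside or almost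
outside each cell. Every cell captures exactly one component of `G'`, which yields the matching, and
restriction to a cell shows that matched weighted components are `L¹`-close
(`exists_perm_components_close`). Characteristic functions at well-chosen frequencies turn this into
closeness of weights, means and scales (`weighted_params_close`), against the lower bound on the
parameter distance. No step depends on the dimension, and only one power of the aspect ratio is
lost, in the isoperimetric step. -/

open MeasureTheory ProbabilityTheory
open scoped ENNReal RealInnerProductSpace

/-! ### Dimension-free Gaussian Poincaré inequality in `L¹`. -/

section GaussianPoincare

variable {E : Type*} [NormedAddCommGroup E] [InnerProductSpace ℝ E] [FiniteDimensional ℝ E]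
  [MeasurableSpace E] [BorelSpace E]

/-- `L` is centred with variance `‖L‖ ^ 2`, and the `L¹` norm is at most the `L²` norm. Pairing a
gradient with an independent Gaussian thus costs no dimension factor. -/
lemma lintegral_enorm_dual_stdGaussian_le (L : StrongDual ℝ E) :
    ∫⁻ y, ‖L y‖ₑ ∂(stdGaussian E) ≤ ‖L‖ₑ := by
  have h2 : ∫⁻ y, ‖L y‖ₑ ^ 2 ∂(stdGaussian E) = ‖L‖ₑ ^ 2 := by
    have h := (IsGaussian.memLp_dual (stdGaussian E) L 2 (by simp)).ofReal_variance_eq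
    rw [variance_dual_stdGaussian, evariance, integral_strongDual_stdGaussian] at h
    simp only [sub_zero] at h
    rw [← h, ENNReal.ofReal_pow (norm_nonneg _), ofReal_norm]
  have h1 : eLpNorm L 1 (stdGaussian E) ≤ eLpNorm L 2 (stdGaussian E) :=
    eLpNorm_le_eLpNorm_of_exponent_le (by norm_num) L.continuous.aestronglyMeasurable
  rw [eLpNorm_one_eq_lintegral_enorm] at h1
  refine h1.trans (le_of_eq ?_)
  rw [eLpNorm_eq_lintegral_rpow_enorm_toReal (by simp) (by simp)]
  simp only [ENNReal.toReal_ofNat, ENNReal.rpow_ofNat, h2]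
  rw [← ENNReal.rpow_natCast, ← ENNReal.rpow_mul]
  norm_num

lemma map_rotation_stdGaussian_prod (θ : ℝ) :
    ((stdGaussian E).prod (stdGaussian E)).map (ContinuousLinearMap.rotation θ) =
      (stdGaussian E).prod (stdGaussian E) :=
  IsGaussian.map_rotation_eq_self_of_forall_strongDual_eq_zero
    integral_strongDual_stdGaussian θ

/-- The path is a quarter circle rather than a segment: position and velocity then form a rotation
of `(x, y)`, so for Gaussian endpoints they are again independent standard Gaussians. -/
lemma enorm_sub_le_lintegral_arc {E : Type*} [NormedAddCommGroup E] [InnerProductSpace ℝ E]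
    {φ : E → ℝ} (hφ : ContDiff ℝ 1 φ) (x y : E) :
    ‖φ y - φ x‖ₑ ≤ ∫⁻ θ in Set.Ioc (0 : ℝ) (Real.pi / 2),
      ‖fderiv ℝ φ (Real.cos θ • x + Real.sin θ • y) (-Real.sin θ • x + Real.cos θ • y)‖ₑ := by
  set γ : ℝ → E := fun θ => Real.cos θ • x + Real.sin θ • y
  have hγ : ∀ θ, HasDerivAt γ (-Real.sin θ • x + Real.cos θ • y) θ := fun θ =>
    ((Real.hasDerivAt_cos θ).smul_const x).add ((Real.hasDerivAt_sin θ).smul_const y)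
  have hd : ∀ θ, HasDerivAt (φ ∘ γ)
      (fderiv ℝ φ (γ θ) (-Real.sin θ • x + Real.cos θ • y)) θ := fun θ =>
    ((hφ.differentiable (by simp)) (γ θ)).hasFDerivAt.comp_hasDerivAt θ (hγ θ)
  have hc : Continuous fun θ => fderiv ℝ φ (γ θ) (-Real.sin θ • x + Real.cos θ • y) := by
    have h1 : Continuous γ := by fun_prop
    exact ((hφ.continuous_fderiv (by simp)).comp h1).clm_apply (by fun_prop)
  have h := intervalIntegral.integral_eq_sub_of_hasDerivAt (a := 0) (b := Real.pi / 2)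
    (fun θ _ => hd θ) (hc.intervalIntegrable _ _)
  have e : φ y - φ x = (φ ∘ γ) (Real.pi / 2) - (φ ∘ γ) 0 := by simp [γ]
  rw [e, ← h, intervalIntegral.integral_of_le (by positivity)]
  exact enorm_integral_le_lintegral_enorm _

/-- Dimension-free `L¹` Poincaré inequality for the standard Gaussian. -/
theorem lintegral_enorm_sub_stdGaussian_le {φ : E → ℝ} (hφ : ContDiff ℝ 1 φ) :
    ∫⁻ p, ‖φ p.2 - φ p.1‖ₑ ∂((stdGaussian E).prod (stdGaussian E)) ≤
      ENNReal.ofReal (Real.pi / 2) * ∫⁻ x, ‖fderiv ℝ φ x‖ₑ ∂(stdGaussian E) := by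
  have hfd : Continuous (fderiv ℝ φ) := hφ.continuous_fderiv (by simp)
  set F : E × E → ℝ≥0∞ := fun p => ‖fderiv ℝ φ p.1 p.2‖ₑ
  have hF : Continuous F := ((hfd.comp continuous_fst).clm_apply continuous_snd).enorm
  have key : ∀ θ, ∫⁻ p, F (ContinuousLinearMap.rotation θ p)
      ∂((stdGaussian E).prod (stdGaussian E)) ≤ ∫⁻ x, ‖fderiv ℝ φ x‖ₑ ∂(stdGaussian E) := by
    intro θ
    rw [← lintegral_map hF.measurable (ContinuousLinearMap.continuous _).measurable,
      map_rotation_stdGaussian_prod, lintegral_prod _ hF.measurable.aemeasurable]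
    exact lintegral_mono fun x => lintegral_enorm_dual_stdGaussian_le _
  calc ∫⁻ p, ‖φ p.2 - φ p.1‖ₑ ∂((stdGaussian E).prod (stdGaussian E))
      ≤ ∫⁻ p, (∫⁻ θ in Set.Ioc (0 : ℝ) (Real.pi / 2), F (ContinuousLinearMap.rotation θ p))
          ∂((stdGaussian E).prod (stdGaussian E)) :=
        lintegral_mono fun p => enorm_sub_le_lintegral_arc hφ p.1 p.2
    _ = ∫⁻ θ in Set.Ioc (0 : ℝ) (Real.pi / 2), ∫⁻ p, F (ContinuousLinearMap.rotation θ p)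
          ∂((stdGaussian E).prod (stdGaussian E)) := by
        apply lintegral_lintegral_swap
        refine (hF.comp ?_).measurable.aemeasurable
        simp only [ContinuousLinearMap.rotation_apply]
        fun_prop
    _ ≤ ∫⁻ θ in Set.Ioc (0 : ℝ) (Real.pi / 2), ∫⁻ x, ‖fderiv ℝ φ x‖ₑ ∂(stdGaussian E) :=
        lintegral_mono fun θ => key θ
    _ = _ := by
        rw [setLIntegral_const, Real.volume_Ioc, sub_zero, mul_comm]

end GaussianPoincare

/-! ### A cutoff on the line. -/

section Ramp

lemma hasDerivAt_max_zero_sq (t : ℝ) : HasDerivAt (fun t : ℝ => max t 0 ^ 2) (2 * max t 0) t := by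
  rcases lt_trichotomy t 0 with h | h | h
  · rw [max_eq_right h.le, mul_zero]
    refine (hasDerivAt_const t (0 : ℝ)).congr_of_eventuallyEq ?_
    filter_upwards [Iio_mem_nhds h] with s hs
    simp [max_eq_right (le_of_lt (Set.mem_Iio.1 hs))]
  · subst h
    rw [hasDerivAt_iff_isLittleO]
    simp only [max_self, sub_zero, mul_zero, smul_zero, ne_eq, OfNat.ofNat_ne_zero,
      not_false_eq_true, zero_pow]
    refine Asymptotics.IsBigO.trans_isLittleO (g := fun s : ℝ => s ^ 2) ?_ ?_
    · refine Asymptotics.isBigO_of_le _ fun s => ?_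
      rcases le_total s 0 with h | h
      · simp [max_eq_right h]; positivity
      · simp [max_eq_left h]
    · simpa using (Asymptotics.isLittleO_pow_id (𝕜 := ℝ) (n := 2) (by norm_num))
  · rw [max_eq_left h.le]
    have := (hasDerivAt_pow 2 t)
    simp only [Nat.cast_ofNat, Nat.add_one_sub_one, pow_one] at this
    refine this.congr_of_eventuallyEq ?_
    filter_upwards [Ioi_mem_nhds h] with s hs
    simp [max_eq_left (le_of_lt (Set.mem_Ioi.1 hs))]

/-- A `C¹` ramp, `0` on `(-∞, 0]` and `1` on `[1, ∞)`. -/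
noncomputable def ramp (t : ℝ) : ℝ :=
  2 * (max t 0 ^ 2 - 2 * max (t - 1 / 2) 0 ^ 2 + max (t - 1) 0 ^ 2)

noncomputable def rampDeriv (t : ℝ) : ℝ :=
  2 * (2 * max t 0 - 2 * (2 * max (t - 1 / 2) 0) + 2 * max (t - 1) 0)

lemma hasDerivAt_ramp (t : ℝ) : HasDerivAt ramp (rampDeriv t) t := by
  have h1 := hasDerivAt_max_zero_sq t
  have h2 := (hasDerivAt_max_zero_sq (t - 1 / 2)).comp_sub_const t (1 / 2)
  have h3 := (hasDerivAt_max_zero_sq (t - 1)).comp_sub_const t 1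
  exact ((h1.sub (h2.const_mul 2)).add h3).const_mul 2

lemma ramp_of_nonpos {t : ℝ} (h : t ≤ 0) : ramp t = 0 := by
  rw [ramp, max_eq_right h, max_eq_right (by linarith), max_eq_right (by linarith)]; ring

lemma ramp_of_one_le {t : ℝ} (h : 1 ≤ t) : ramp t = 1 := by
  rw [ramp, max_eq_left (by linarith), max_eq_left (by linarith), max_eq_left (by linarith)]; ring

lemma rampDeriv_of_nonpos {t : ℝ} (h : t ≤ 0) : rampDeriv t = 0 := by
  rw [rampDeriv, max_eq_right h, max_eq_right (by linarith), max_eq_right (by linarith)]; ring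

lemma rampDeriv_of_one_le {t : ℝ} (h : 1 ≤ t) : rampDeriv t = 0 := by
  rw [rampDeriv, max_eq_left (by linarith), max_eq_left (by linarith), max_eq_left (by linarith)]
  ring

lemma abs_rampDeriv_le (t : ℝ) : |rampDeriv t| ≤ 2 := by
  rw [rampDeriv, abs_le]
  rcases le_total t 0 with h | h <;> rcases le_total (t - 1 / 2) 0 with h' | h' <;>
    rcases le_total (t - 1) 0 with h'' | h'' <;>
    simp only [max_eq_left, max_eq_right, h, h', h''] <;> constructor <;> linarith

lemma contDiff_ramp : ContDiff ℝ 1 ramp := by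
  rw [contDiff_one_iff_deriv]
  refine ⟨fun t => (hasDerivAt_ramp t).differentiableAt, ?_⟩
  rw [funext fun t => (hasDerivAt_ramp t).deriv]
  unfold rampDeriv
  fun_prop

end Ramp

/-! ### Log-sum-exp smoothing of a maximum. -/

section SoftMax

variable {E ι : Type*} [NormedAddCommGroup E] [InnerProductSpace ℝ E] [Fintype ι]

/-- Smooth approximation of the maximum of the affine functions `x ↦ ⟪v l, x⟫ + a l`. -/
noncomputable def softMax (β : ℝ) (v : ι → E) (a : ι → ℝ) (x : E) : ℝ :=
  β⁻¹ * Real.log (∑ l, Real.exp (β * (⟪v l, x⟫ + a l)))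

variable {β : ℝ} {v : ι → E} {a : ι → ℝ}

lemma sum_exp_pos [Nonempty ι] (f : ι → ℝ) : 0 < ∑ l, Real.exp (f l) :=
  Finset.sum_pos (fun _ _ => Real.exp_pos _) Finset.univ_nonempty

lemma le_softMax (hβ : 0 < β) (x : E) (l : ι) : ⟪v l, x⟫ + a l ≤ softMax β v a x := by
  rw [softMax, le_inv_mul_iff₀ hβ, Real.le_log_iff_exp_le (Finset.sum_pos' (fun _ _ =>
    (Real.exp_pos _).le) ⟨l, Finset.mem_univ _, Real.exp_pos _⟩)]
  exact Finset.single_le_sum (f := fun l => Real.exp (β * (⟪v l, x⟫ + a l)))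
    (fun l _ => (Real.exp_pos _).le) (Finset.mem_univ l)

/-- The error does not depend on `x` and vanishes as `β` grows, so the number of affine functions
can be absorbed into `β`. -/
lemma softMax_le [Nonempty ι] (hβ : 0 < β) {x : E} {M : ℝ} (h : ∀ l, ⟪v l, x⟫ + a l ≤ M) :
    softMax β v a x ≤ M + Real.log (Fintype.card ι) / β := by
  have hc : (0 : ℝ) < Fintype.card ι := by exact_mod_cast Fintype.card_pos
  have : Real.log (∑ l, Real.exp (β * (⟪v l, x⟫ + a l))) ≤
      Real.log (Fintype.card ι * Real.exp (β * M)) := by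
    apply Real.log_le_log (sum_exp_pos _)
    calc _ ≤ ∑ l : ι, Real.exp (β * M) := Finset.sum_le_sum fun l _ =>
          Real.exp_le_exp.2 (mul_le_mul_of_nonneg_left (h l) hβ.le)
      _ = _ := by simp
  rw [Real.log_mul hc.ne' (Real.exp_pos _).ne', Real.log_exp] at this
  rw [softMax, inv_mul_le_iff₀ hβ]
  refine this.trans (le_of_eq ?_)
  field_simp
  ring

lemma hasFDerivAt_softMax [Nonempty ι] (x : E) :
    HasFDerivAt (softMax β v a) (β⁻¹ • ((∑ l, Real.exp (β * (⟪v l, x⟫ + a l)))⁻¹ •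
      ∑ l, Real.exp (β * (⟪v l, x⟫ + a l)) • β • innerSL ℝ (v l))) x := by
  have h : ∀ l, HasFDerivAt (fun x => β * (⟪v l, x⟫ + a l)) (β • innerSL ℝ (v l)) x := fun l =>
    ((innerSL ℝ (v l)).hasFDerivAt.add_const (a l)).const_mul β
  exact ((HasFDerivAt.fun_sum fun l _ => (h l).exp).log (sum_exp_pos _).ne').const_mul β⁻¹

lemma contDiff_softMax [Nonempty ι] : ContDiff ℝ 1 (softMax β v a) := by
  unfold softMax
  refine contDiff_const.mul (ContDiff.log ?_ fun x => (sum_exp_pos _).ne')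
  refine ContDiff.sum fun l _ => (contDiff_const.mul (ContDiff.add ?_ contDiff_const)).exp
  exact (innerSL ℝ (v l)).contDiff

/-- The gradient is a convex combination of the `v l`, so the bound involves neither `β` nor their
number. -/
lemma norm_fderiv_softMax_le [Nonempty ι] (hβ : 0 < β) {s : ℝ} (hs : ∀ l, ‖v l‖ ≤ s) (x : E) :
    ‖fderiv ℝ (softMax β v a) x‖ ≤ s := by
  rw [(hasFDerivAt_softMax x).fderiv, norm_smul, norm_smul, norm_inv, norm_inv,
    Real.norm_of_nonneg hβ.le, Real.norm_of_nonneg (sum_exp_pos _).le, inv_mul_le_iff₀ hβ,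
    inv_mul_le_iff₀ (sum_exp_pos _), Finset.sum_mul]
  refine norm_sum_le_of_le _ fun l _ => ?_
  rw [norm_smul, norm_smul, Real.norm_of_nonneg (Real.exp_pos _).le, Real.norm_of_nonneg hβ.le,
    innerSL_apply_norm]
  have := hs l
  gcongr

end SoftMax

/-! ### Gaussian isoperimetry for polyhedra. -/

section Isoperimetry

variable {E ι : Type*} [NormedAddCommGroup E] [InnerProductSpace ℝ E] [FiniteDimensional ℝ E]
  [MeasurableSpace E] [BorelSpace E] [Fintype ι]

/-- Isoperimetric inequality for the standard Gaussian and a polyhedron: the polyhedron and the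
set at height at least `D` above it are separated by a layer of large measure. -/
theorem stdGaussian_polyhedron_layer [Nonempty ι] (v : ι → E) (a : ι → ℝ) {s D : ℝ}
    (hs : ∀ l, ‖v l‖ ≤ s) (hD : 0 < D) {A B : Set E} (hA : ∀ x ∈ A, ∀ l, ⟪v l, x⟫ + a l ≤ 0)
    (hB : ∀ x ∈ B, ∃ l, D ≤ ⟪v l, x⟫ + a l) {C : Set E} (hC : MeasurableSet C)
    (hAm : MeasurableSet A) (hBm : MeasurableSet B)
    (hAC : ∀ x ∉ C, (∀ l, ⟪v l, x⟫ + a l ≤ 0) ∨ ∃ l, D ≤ ⟪v l, x⟫ + a l) :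
    D * ((stdGaussian E).real A * (stdGaussian E).real B) ≤
      3 * Real.pi * s * (stdGaussian E).real C := by
  have hs0 : 0 ≤ s := (norm_nonneg _).trans (hs (Classical.arbitrary ι))
  set K := Real.log (Fintype.card ι)
  have hK : 0 ≤ K := Real.log_natCast_nonneg _
  -- Makes the smoothing error at most `D / 3`; the `+ 1` keeps `β` positive for a single face.
  set β := 3 * (K + 1) / D
  have hβ : 0 < β := by positivity
  have hKβ : K / β ≤ D / 3 := by
    rw [div_le_iff₀ hβ]
    simp only [β]
    field_simp
    linarith
  -- The ramp rises while the soft maximum runs from `D / 3` to `2 * D / 3`. The soft maximum is at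
  -- most `D / 3` on the polyhedron and at least `D` on the far side, so the gradient of `φ` lives
  -- on `C`.
  set φ : E → ℝ := fun x => ramp (3 / D * softMax β v a x - 1)
  have hφ : ContDiff ℝ 1 φ :=
    contDiff_ramp.comp ((contDiff_const.mul contDiff_softMax).sub contDiff_const)
  have hφd : ∀ x, fderiv ℝ φ x = rampDeriv (3 / D * softMax β v a x - 1) •
      (3 / D) • fderiv ℝ (softMax β v a) x := fun x =>
    ((hasDerivAt_ramp _).comp_hasFDerivAt x (((hasFDerivAt_softMax x).const_mul (3 / D)).sub_const
      1)).fderiv.trans (by rw [(hasFDerivAt_softMax x).fderiv])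
  have lowX : ∀ x, (∀ l, ⟪v l, x⟫ + a l ≤ 0) → 3 / D * softMax β v a x - 1 ≤ 0 := fun x hx => by
    have := (softMax_le hβ hx).trans (by rwa [zero_add] : _ ≤ D / 3)
    rw [sub_nonpos, div_mul_eq_mul_div, div_le_one hD]; linarith
  have highX : ∀ x, (∃ l, D ≤ ⟪v l, x⟫ + a l) → 1 ≤ 3 / D * softMax β v a x - 1 := by
    rintro x ⟨l, hl⟩
    have := hl.trans (le_softMax hβ x l)
    rw [le_sub_iff_add_le, div_mul_eq_mul_div, le_div_iff₀ hD]; linarith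
  have hgrad : ∀ x, ‖fderiv ℝ φ x‖ₑ ≤ C.indicator (fun _ => ENNReal.ofReal (6 / D * s)) x := by
    intro x
    by_cases hx : x ∈ C
    · rw [Set.indicator_of_mem hx, ← ofReal_norm, hφd, norm_smul, norm_smul,
        Real.norm_of_nonneg (by positivity : 0 ≤ 3 / D)]
      apply ENNReal.ofReal_le_ofReal
      calc _ ≤ 2 * (3 / D * s) := by
            gcongr
            · exact abs_rampDeriv_le _
            · exact norm_fderiv_softMax_le hβ hs x
        _ = _ := by ring
    · have : rampDeriv (3 / D * softMax β v a x - 1) = 0 := by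
        rcases hAC x hx with h | h
        · exact rampDeriv_of_nonpos (lowX x h)
        · exact rampDeriv_of_one_le (highX x h)
      rw [hφd, this, zero_smul, ← ofReal_norm, norm_zero, ENNReal.ofReal_zero]
      exact zero_le
  -- `φ` jumps from `0` to `1` across `A ×ˢ B`.
  have h1 : stdGaussian E A * stdGaussian E B ≤
      ∫⁻ p, ‖φ p.2 - φ p.1‖ₑ ∂((stdGaussian E).prod (stdGaussian E)) := by
    rw [← Measure.prod_prod, ← lintegral_indicator_one (hAm.prod hBm)]
    refine lintegral_mono fun p => ?_
    by_cases hp : p ∈ A ×ˢ B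
    · have e1 : φ p.1 = 0 := ramp_of_nonpos (lowX _ (hA _ hp.1))
      have e2 : φ p.2 = 1 := ramp_of_one_le (highX _ (hB _ hp.2))
      simp [hp, e1, e2]
    · simp [hp]
  have h2 := h1.trans (lintegral_enorm_sub_stdGaussian_le hφ)
  have h3 : ∫⁻ x, ‖fderiv ℝ φ x‖ₑ ∂(stdGaussian E) ≤
      ENNReal.ofReal (6 / D * s) * stdGaussian E C := by
    refine (lintegral_mono hgrad).trans ?_
    rw [lintegral_indicator_const hC]
  have h4 := h2.trans (mul_le_mul_right h3 _)
  have h5 := ENNReal.toReal_mono (by finiteness) h4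
  rw [ENNReal.toReal_mul, ENNReal.toReal_mul, ENNReal.toReal_mul,
    ENNReal.toReal_ofReal (by positivity), ENNReal.toReal_ofReal (by positivity)] at h5
  have h6 := mul_le_mul_of_nonneg_left h5 hD.le
  refine h6.trans (le_of_eq ?_)
  simp only [Measure.real]
  field_simp
  ring

end Isoperimetry

/-! ### Spherical Gaussian measures: Fourier transform, tails, isoperimetry. -/

section SphericalGaussian

variable {d : ℕ} {m : EuclideanSpace ℝ (Fin d)} {s : ℝ}

lemma continuous_sphericalGaussianPdf : Continuous (sphericalGaussianPdf m s) := by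
  unfold sphericalGaussianPdf
  fun_prop

lemma sphericalGaussianPdf_nonneg (hs : 0 < s) (x : EuclideanSpace ℝ (Fin d)) :
    0 ≤ sphericalGaussianPdf m s x := by
  unfold sphericalGaussianPdf
  positivity

lemma integral_sphericalGaussianPdf_mul_cexp (hs : 0 < s) (t : EuclideanSpace ℝ (Fin d)) :
    ∫ x, (sphericalGaussianPdf m s x : ℂ) * Complex.exp (⟪x, t⟫ * Complex.I) =
      Complex.exp (⟪m, t⟫ * Complex.I - s ^ 2 * ‖t‖ ^ 2 / (4 * Real.pi)) := by
  have hπ : (Real.pi : ℂ) ≠ 0 := by exact_mod_cast Real.pi_ne_zero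
  have hs' : (s : ℂ) ≠ 0 := by exact_mod_cast hs.ne'
  have hb : 0 < ((Real.pi / s ^ 2 : ℝ) : ℂ).re := by
    rw [Complex.ofReal_re]; positivity
  have h := GaussianFourier.integral_cexp_neg_mul_sq_norm_add hb Complex.I t
  have hp : ((Real.pi : ℂ) / ((Real.pi / s ^ 2 : ℝ) : ℂ)) ^
      (Module.finrank ℝ (EuclideanSpace ℝ (Fin d)) / 2 : ℂ) = (s : ℂ) ^ d := by
    have e1 : (Real.pi : ℂ) / ((Real.pi / s ^ 2 : ℝ) : ℂ) = ((s ^ 2 : ℝ) : ℂ) := by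
      push_cast; field_simp
    have e2 : ((d : ℂ) / 2) = (((d : ℝ) / 2 : ℝ) : ℂ) := by push_cast; ring
    rw [e1, finrank_euclideanSpace_fin, e2, ← Complex.ofReal_cpow (by positivity),
      ← Real.rpow_natCast, ← Real.rpow_mul hs.le]
    norm_num [mul_div_cancel₀]
  rw [hp] at h
  rw [← integral_add_right_eq_self _ m]
  have e : ∀ x : EuclideanSpace ℝ (Fin d), (sphericalGaussianPdf m s (x + m) : ℂ) *
      Complex.exp (⟪x + m, t⟫ * Complex.I) =
      (((s : ℂ) ^ d)⁻¹ * Complex.exp (⟪m, t⟫ * Complex.I)) *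
        Complex.exp (-((Real.pi / s ^ 2 : ℝ) : ℂ) * ‖x‖ ^ 2 + Complex.I * ⟪t, x⟫) := by
    intro x
    rw [sphericalGaussianPdf, add_sub_cancel_right, inner_add_left, real_inner_comm t x]
    push_cast
    rw [mul_assoc, mul_assoc, ← Complex.exp_add, ← Complex.exp_add]
    congr 2
    ring
  simp_rw [e]
  rw [integral_const_mul, h, sub_eq_add_neg, Complex.exp_add]
  have e3 : Complex.I ^ 2 * (‖t‖ : ℂ) ^ 2 / (4 * ((Real.pi / s ^ 2 : ℝ) : ℂ)) =
      -(s ^ 2 * ‖t‖ ^ 2 / (4 * Real.pi)) := by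
    push_cast; rw [Complex.I_sq]; field_simp
  rw [e3]
  field_simp

lemma integrable_sphericalGaussianPdf (hs : 0 < s) :
    Integrable (sphericalGaussianPdf (d := d) m s) := by
  have hb : 0 < ((Real.pi / s ^ 2 : ℝ) : ℂ).re := by
    rw [Complex.ofReal_re]; positivity
  have h := (GaussianFourier.integrable_cexp_neg_mul_sq_norm_add hb 0
    (0 : EuclideanSpace ℝ (Fin d))).norm
  have h2 := (h.comp_sub_right m).const_mul (s ^ d)⁻¹
  refine h2.congr (ae_of_all _ fun x => ?_)
  simp only [sphericalGaussianPdf, Complex.norm_exp]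
  congr 2
  simp only [zero_mul, add_zero, ← Complex.ofReal_pow, ← Complex.ofReal_neg, ← Complex.ofReal_mul,
    Complex.ofReal_re]
  ring

lemma integral_sphericalGaussianPdf (hs : 0 < s) :
    ∫ x : EuclideanSpace ℝ (Fin d), sphericalGaussianPdf m s x = 1 := by
  have h := integral_sphericalGaussianPdf_mul_cexp (m := m) hs 0
  simp only [inner_zero_right, Complex.ofReal_zero, zero_mul, Complex.exp_zero, mul_one,
    norm_zero] at h
  rw [integral_complex_ofReal] at h
  have : ((∫ x : EuclideanSpace ℝ (Fin d), sphericalGaussianPdf m s x : ℝ) : ℂ) = 1 := by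
    rw [h]; simp
  exact_mod_cast this

/-- The spherical Gaussian measure. -/
noncomputable def sphericalGaussian (m : EuclideanSpace ℝ (Fin d)) (s : ℝ) :
    Measure (EuclideanSpace ℝ (Fin d)) :=
  volume.withDensity fun x => ENNReal.ofReal (sphericalGaussianPdf m s x)

lemma sphericalGaussian_real_apply (hs : 0 < s) {S : Set (EuclideanSpace ℝ (Fin d))}
    (hS : MeasurableSet S) :
    (sphericalGaussian m s).real S = ∫ x in S, sphericalGaussianPdf m s x := by
  rw [Measure.real, sphericalGaussian, withDensity_apply _ hS,
    ← ofReal_integral_eq_lintegral_ofReal (integrable_sphericalGaussianPdf hs).integrableOn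
      (ae_of_all _ fun x => sphericalGaussianPdf_nonneg hs x), ENNReal.toReal_ofReal]
  exact setIntegral_nonneg hS fun x _ => sphericalGaussianPdf_nonneg hs x

lemma isProbabilityMeasure_sphericalGaussian (hs : 0 < s) :
    IsProbabilityMeasure (sphericalGaussian m s) := by
  constructor
  rw [sphericalGaussian, withDensity_apply _ MeasurableSet.univ, Measure.restrict_univ,
    ← ofReal_integral_eq_lintegral_ofReal (integrable_sphericalGaussianPdf hs)
      (ae_of_all _ fun x => sphericalGaussianPdf_nonneg hs x), integral_sphericalGaussianPdf hs,
    ENNReal.ofReal_one]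

/-- Both sides have the same characteristic function. This transports isoperimetry from the standard
Gaussian. -/
lemma sphericalGaussian_eq_map (hs : 0 < s) :
    sphericalGaussian m s = (stdGaussian (EuclideanSpace ℝ (Fin d))).map
      (fun x => m + (s / √(2 * Real.pi)) • x) := by
  have := isProbabilityMeasure_sphericalGaussian (m := m) hs
  have hmeas : Measurable fun x : EuclideanSpace ℝ (Fin d) => m + (s / √(2 * Real.pi)) • x := by
    fun_prop
  have : IsProbabilityMeasure ((stdGaussian (EuclideanSpace ℝ (Fin d))).map
      (fun x => m + (s / √(2 * Real.pi)) • x)) :=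
    Measure.isProbabilityMeasure_map hmeas.aemeasurable
  apply Measure.ext_of_charFun
  ext t
  have hr : charFun ((stdGaussian (EuclideanSpace ℝ (Fin d))).map
      (fun x => m + (s / √(2 * Real.pi)) • x)) t = Complex.exp (⟪m, t⟫ * Complex.I) *
      charFun (stdGaussian (EuclideanSpace ℝ (Fin d))) ((s / √(2 * Real.pi)) • t) := by
    rw [charFun_apply, integral_map hmeas.aemeasurable (by fun_prop), charFun_apply,
      ← integral_const_mul]
    congr 1
    ext x
    rw [← Complex.exp_add, inner_add_left, real_inner_smul_left, real_inner_smul_right]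
    push_cast
    ring_nf
  rw [hr, charFun_stdGaussian, charFun_apply, sphericalGaussian,
    integral_withDensity_eq_integral_toReal_smul
      (continuous_sphericalGaussianPdf.measurable.ennreal_ofReal) (by simp)]
  simp_rw [ENNReal.toReal_ofReal (sphericalGaussianPdf_nonneg hs _), Complex.real_smul]
  rw [integral_sphericalGaussianPdf_mul_cexp hs, ← Complex.exp_add]
  congr 1
  rw [sub_eq_add_neg]
  congr 1
  have : (‖(s / √(2 * Real.pi)) • t‖ ^ 2 : ℝ) = s ^ 2 * ‖t‖ ^ 2 / (2 * Real.pi) := by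
    rw [norm_smul, mul_pow, Real.norm_eq_abs, sq_abs, div_pow, Real.sq_sqrt (by positivity)]
    ring
  have h2 : (‖(s / √(2 * Real.pi)) • t‖ : ℂ) ^ 2 = s ^ 2 * ‖t‖ ^ 2 / (2 * Real.pi) := by
    exact_mod_cast congrArg Complex.ofReal this
  rw [h2]
  ring

/-- On the half-space, `‖x - m - t • e‖ ^ 2 ≤ ‖x - m‖ ^ 2 - t ^ 2`, so the density is at most the
exponential factor times the density recentred at `m + t • e`. -/
lemma sphericalGaussian_halfspace_le (hs : 0 < s) {e : EuclideanSpace ℝ (Fin d)} (he : ‖e‖ = 1)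
    {t : ℝ} (ht : 0 ≤ t) :
    (sphericalGaussian m s).real {x | t < ⟪e, x - m⟫} ≤
      Real.exp (-(Real.pi * t ^ 2 / s ^ 2)) := by
  have hS : MeasurableSet {x : EuclideanSpace ℝ (Fin d) | t < ⟪e, x - m⟫} :=
    measurableSet_lt measurable_const (by fun_prop)
  rw [sphericalGaussian_real_apply hs hS]
  have hi := (integrable_sphericalGaussianPdf (m := m + t • e) hs).const_mul
    (Real.exp (-(Real.pi * t ^ 2 / s ^ 2)))
  calc _ ≤ ∫ x in {x | t < ⟪e, x - m⟫}, Real.exp (-(Real.pi * t ^ 2 / s ^ 2)) *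
          sphericalGaussianPdf (m + t • e) s x := by
        refine setIntegral_mono_on (integrable_sphericalGaussianPdf hs).integrableOn
          hi.integrableOn hS fun x hx => ?_
        simp only [sphericalGaussianPdf]
        rw [mul_left_comm, ← Real.exp_add]
        gcongr
        rw [← sub_sub, norm_sub_sq_real (x - m) (t • e), real_inner_smul_right, norm_smul, he,
          mul_one, Real.norm_eq_abs, sq_abs, ← neg_add, neg_le_neg_iff, ← add_div]
        gcongr
        rw [← mul_add]
        gcongr
        rw [real_inner_comm]
        have hx' : t < ⟪e, x - m⟫ := hx
        nlinarith
    _ ≤ ∫ x, Real.exp (-(Real.pi * t ^ 2 / s ^ 2)) * sphericalGaussianPdf (m + t • e) s x :=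
        setIntegral_le_integral hi (ae_of_all _ fun x =>
          mul_nonneg (Real.exp_pos _).le (sphericalGaussianPdf_nonneg hs x))
    _ = _ := by rw [integral_const_mul, integral_sphericalGaussianPdf hs, mul_one]

/-- The layer above a polyhedron with unit normals carries a large part of a Gaussian measure that
charges both sides of the layer. -/
lemma sphericalGaussian_polyhedron_layer {ι : Type*} [Fintype ι] [Nonempty ι] (hs : 0 < s)
    (v : ι → EuclideanSpace ℝ (Fin d)) (a : ι → ℝ) {D : ℝ} (hv : ∀ l, ‖v l‖ ≤ 1) (hD : 0 < D)
    {A B C : Set (EuclideanSpace ℝ (Fin d))} (hA : ∀ x ∈ A, ∀ l, ⟪v l, x⟫ + a l ≤ 0)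
    (hB : ∀ x ∈ B, ∃ l, D ≤ ⟪v l, x⟫ + a l) (hC : MeasurableSet C)
    (hAm : MeasurableSet A) (hBm : MeasurableSet B)
    (hAC : ∀ x ∉ C, (∀ l, ⟪v l, x⟫ + a l ≤ 0) ∨ ∃ l, D ≤ ⟪v l, x⟫ + a l) :
    D * ((sphericalGaussian m s).real A * (sphericalGaussian m s).real B) ≤
      10 * s * (sphericalGaussian m s).real C := by
  set r := s / √(2 * Real.pi)
  have hr : 0 < r := by positivity
  have hrs : r ≤ s := div_le_self hs.le (Real.one_le_sqrt.2 (by linarith [Real.pi_gt_three]))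
  have hmeas : Measurable fun x : EuclideanSpace ℝ (Fin d) => m + r • x := by fun_prop
  have hin : ∀ x l, ⟪v l, m + r • x⟫ + a l = ⟪r • v l, x⟫ + (⟪v l, m⟫ + a l) := fun x l => by
    rw [inner_add_right, real_inner_smul_left, real_inner_smul_right]; ring
  have h := stdGaussian_polyhedron_layer (fun l => r • v l) (fun l => ⟪v l, m⟫ + a l) (s := r)
    (fun l => by
      rw [norm_smul, Real.norm_of_nonneg hr.le]; exact mul_le_of_le_one_right hr.le (hv l)) hD
    (A := (fun x => m + r • x) ⁻¹' A) (B := (fun x => m + r • x) ⁻¹' B)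
    (C := (fun x => m + r • x) ⁻¹' C)
    (fun x hx l => by rw [← hin]; exact hA _ hx l)
    (fun x hx => by simp_rw [← hin]; exact hB _ hx) (hmeas hC) (hmeas hAm) (hmeas hBm)
    (fun x hx => by simp_rw [← hin]; exact hAC _ hx)
  rw [sphericalGaussian_eq_map hs, map_measureReal_apply hmeas hAm, map_measureReal_apply hmeas hBm,
    map_measureReal_apply hmeas hC]
  refine h.trans (mul_le_mul_of_nonneg_right ?_ measureReal_nonneg)
  have : 3 * Real.pi ≤ 10 := by linarith [Real.pi_lt_d2]
  gcongr

end SphericalGaussian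

/-! ### Recovering parameters from `L¹` closeness. -/

section Comparison

variable {d : ℕ} {m m' : EuclideanSpace ℝ (Fin d)} {s s' : ℝ}

lemma norm_charFun_sub_le (hs : 0 < s) (hs' : 0 < s') (t : EuclideanSpace ℝ (Fin d)) :
    ‖Complex.exp (⟪m, t⟫ * Complex.I - s ^ 2 * ‖t‖ ^ 2 / (4 * Real.pi)) -
      Complex.exp (⟪m', t⟫ * Complex.I - s' ^ 2 * ‖t‖ ^ 2 / (4 * Real.pi))‖ ≤
      ∫ x, |sphericalGaussianPdf m s x - sphericalGaussianPdf m' s' x| := by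
  have hi : ∀ {m : EuclideanSpace ℝ (Fin d)} {s : ℝ}, 0 < s → Integrable fun x =>
      (sphericalGaussianPdf m s x : ℂ) * Complex.exp (⟪x, t⟫ * Complex.I) := fun {m s} hs =>
    (integrable_sphericalGaussianPdf hs).ofReal.mul_bdd (c := 1) (by fun_prop)
      (ae_of_all _ fun x => by rw [Complex.norm_exp_ofReal_mul_I])
  rw [← integral_sphericalGaussianPdf_mul_cexp hs, ← integral_sphericalGaussianPdf_mul_cexp hs',
    ← integral_sub (hi hs) (hi hs')]
  refine (norm_integral_le_integral_norm _).trans (le_of_eq ?_)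
  congr 1
  ext x
  rw [← sub_mul, norm_mul, Complex.norm_exp_ofReal_mul_I, mul_one, ← Complex.ofReal_sub,
    Complex.norm_real, Real.norm_eq_abs]

lemma norm_exp_gaussian (a : ℝ) (t : EuclideanSpace ℝ (Fin d)) :
    ‖Complex.exp (a * Complex.I - s ^ 2 * ‖t‖ ^ 2 / (4 * Real.pi))‖ =
      Real.exp (-(s ^ 2 * ‖t‖ ^ 2 / (4 * Real.pi))) := by
  have : (a * Complex.I - s ^ 2 * ‖t‖ ^ 2 / (4 * Real.pi) : ℂ) =
      ((-(s ^ 2 * ‖t‖ ^ 2 / (4 * Real.pi)) : ℝ) : ℂ) + a * Complex.I := by push_cast; ring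
  rw [this, Complex.exp_add, norm_mul, Complex.norm_exp_ofReal_mul_I, mul_one,
    Complex.norm_exp_ofReal]

/-- At a frequency of norm `2π / s'` the moduli are `exp (-π r²)` and `exp (-π)` with `r = s / s'`,
and their gap is at least `π (1 - r) exp (-π)`. With `exp π ≤ 57` and `π > 3` this gives `1 - r ≤ 19
x`; then `r ≥ 1 / 2` doubles the constant to `38`. -/
lemma scale_sub_le (hd : 0 < d) (hs : 0 < s) (hs' : 0 < s') (hle : s ≤ s') {x : ℝ}
    (hx : ∫ y, |sphericalGaussianPdf m s y - sphericalGaussianPdf m' s' y| ≤ x)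
    (hx1 : x ≤ 1 / 40) : s' - s ≤ 38 * x * s := by
  have : Nonempty (Fin d) := ⟨⟨0, hd⟩⟩
  obtain ⟨u, hu⟩ : ∃ u : EuclideanSpace ℝ (Fin d), ‖u‖ = 1 := exists_norm_eq _ zero_le_one
  have h := (norm_sub_norm_le _ _).trans
    ((norm_charFun_sub_le (m := m) (m' := m') hs hs' ((2 * Real.pi / s') • u)).trans hx)
  rw [norm_exp_gaussian, norm_exp_gaussian, norm_smul, hu, mul_one, Real.norm_of_nonneg
    (by positivity)] at h
  set r := s / s'
  have hr : r ≤ 1 := (div_le_one hs').2 hle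
  have hr0 : 0 < r := by positivity
  have e1 : s ^ 2 * (2 * Real.pi / s') ^ 2 / (4 * Real.pi) = Real.pi * r ^ 2 := by
    simp only [r]; field_simp; ring
  have e2 : s' ^ 2 * (2 * Real.pi / s') ^ 2 / (4 * Real.pi) = Real.pi := by
    field_simp; ring
  rw [e1, e2] at h
  have h1 : Real.exp (-Real.pi) * (Real.pi * (1 - r)) ≤ x := by
    refine le_trans ?_ h
    have : Real.exp (-(Real.pi * r ^ 2)) =
        Real.exp (-Real.pi) * Real.exp (Real.pi * (1 - r ^ 2)) := by
      rw [← Real.exp_add]; ring_nf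
    rw [this]
    have h2 := Real.add_one_le_exp (Real.pi * (1 - r ^ 2))
    have h3 : Real.pi * (1 - r) ≤ Real.pi * (1 - r ^ 2) := by
      gcongr; nlinarith
    nlinarith [Real.exp_pos (-Real.pi)]
  have hx0 : 0 ≤ x := (integral_nonneg fun _ => abs_nonneg _).trans hx
  have h2 : Real.exp Real.pi ≤ 57 := by
    calc Real.exp Real.pi ≤ Real.exp 1 ^ 4 := by
          rw [← Real.exp_nat_mul, Real.exp_le_exp]; push_cast; linarith [Real.pi_lt_four]
      _ ≤ 2.72 ^ 4 := by gcongr; linarith [Real.exp_one_lt_d9]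
      _ ≤ 57 := by norm_num
  have h3 : 1 - r ≤ 19 * x := by
    rw [Real.exp_neg, inv_mul_le_iff₀ (Real.exp_pos _)] at h1
    have h4 : 3 * (1 - r) ≤ Real.pi * (1 - r) :=
      mul_le_mul_of_nonneg_right Real.pi_gt_three.le (by linarith)
    have h5 : Real.exp Real.pi * x ≤ 57 * x := by gcongr
    linarith
  have h4 : s = r * s' := by simp only [r]; field_simp
  have h5 : 1 / 2 ≤ r := by linarith
  rw [h4]
  have : 1 - r ≤ 38 * x * r := by nlinarith
  nlinarith

/-- The frequency points along `m' - m`. Once the phase of `m` is factored out, the term with scale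
`s` is real, so the imaginary part sees only the phase difference. -/
lemma norm_mean_sub_le (hs : 0 < s) (hs' : 0 < s') {x : ℝ}
    (hx : ∫ y, |sphericalGaussianPdf m s y - sphericalGaussianPdf m' s' y| ≤ x)
    (hx1 : x < 1 / 2) : ‖m - m'‖ ≤ 2 * x * s' := by
  have hx0 : 0 ≤ x := (integral_nonneg fun _ => abs_nonneg _).trans hx
  rw [norm_sub_rev]
  set M := ‖m' - m‖
  rcases (norm_nonneg (m' - m)).eq_or_lt with hM | hM
  · simp only [M, ← hM]; positivity
  -- The bound `R ≥ M` keeps the phase within `[0, π / 2]`, where sine dominates its chord; `R ≥ s'`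
  -- keeps the damping factor above `3 / 4`.
  set R := max M s'
  have hR : 0 < R := lt_max_of_lt_right hs'
  set t : EuclideanSpace ℝ (Fin d) := (Real.pi / (2 * R * M)) • (m' - m)
  have ht : ‖t‖ = Real.pi / (2 * R) := by
    simp only [t]
    rw [norm_smul, Real.norm_of_nonneg (by positivity)]
    change Real.pi / (2 * R * M) * M = _
    have : 0 < M := hM
    field_simp
  have hin : ⟪m' - m, t⟫ = Real.pi / 2 * (M / R) := by
    simp only [t]
    rw [real_inner_smul_right, real_inner_self_eq_norm_sq]
    change Real.pi / (2 * R * M) * M ^ 2 = _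
    have : 0 < M := hM
    field_simp
  have h := (norm_charFun_sub_le (m := m) (m' := m') hs hs' t).trans hx
  set A' := Real.exp (-(s' ^ 2 * ‖t‖ ^ 2 / (4 * Real.pi)))
  have hA' : 3 / 4 ≤ A' := by
    have h1 := Real.add_one_le_exp (-(s' ^ 2 * ‖t‖ ^ 2 / (4 * Real.pi)))
    have h2 : s' ^ 2 * ‖t‖ ^ 2 / (4 * Real.pi) ≤ 1 / 4 := by
      have h3 : s' * ‖t‖ ≤ Real.pi / 2 := by
        rw [ht]
        have : s' / R ≤ 1 := (div_le_one hR).2 (le_max_right _ _)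
        calc s' * (Real.pi / (2 * R)) = Real.pi / 2 * (s' / R) := by field_simp
          _ ≤ Real.pi / 2 * 1 := by gcongr
          _ = _ := mul_one _
      rw [← mul_pow, div_le_iff₀ (by positivity)]
      have := Real.pi_lt_four
      calc (s' * ‖t‖) ^ 2 ≤ (Real.pi / 2) ^ 2 := by gcongr
        _ ≤ _ := by nlinarith [Real.pi_pos]
    linarith
  have h2 : Real.sin (Real.pi / 2 * (M / R)) * A' ≤ x := by
    refine le_trans ?_ h
    have e1 : Complex.exp (⟪m, t⟫ * Complex.I - s ^ 2 * ‖t‖ ^ 2 / (4 * Real.pi)) -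
        Complex.exp (⟪m', t⟫ * Complex.I - s' ^ 2 * ‖t‖ ^ 2 / (4 * Real.pi)) =
        Complex.exp (⟪m, t⟫ * Complex.I) *
          ((Real.exp (-(s ^ 2 * ‖t‖ ^ 2 / (4 * Real.pi))) : ℂ) -
            A' * Complex.exp ((Real.pi / 2 * (M / R) : ℝ) * Complex.I)) := by
      rw [← hin, inner_sub_left]
      simp only [A']
      push_cast
      rw [mul_sub, ← Complex.exp_add, ← Complex.exp_add, ← Complex.exp_add]
      congr 2
      ring
    rw [e1, norm_mul, Complex.norm_exp_ofReal_mul_I, one_mul]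
    refine le_trans ?_ (Complex.abs_im_le_norm _)
    rw [Complex.sub_im, Complex.ofReal_im, Complex.im_ofReal_mul,
      Complex.exp_ofReal_mul_I_im, zero_sub, abs_neg, mul_comm]
    exact le_abs_self _
  have hMR : M / R ≤ 1 := (div_le_one hR).2 (le_max_left _ _)
  have hMR0 : 0 ≤ M / R := by positivity
  have h3 := Real.mul_le_sin (x := Real.pi / 2 * (M / R)) (by positivity)
    (mul_le_of_le_one_right (by positivity) hMR)
  have e3 : 2 / Real.pi * (Real.pi / 2 * (M / R)) = M / R := by field_simp
  rw [e3] at h3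
  have h4 : M / R ≤ 2 * x := by nlinarith
  -- If `R = M`, the bound reads `1 ≤ 2 * x`, which is excluded.
  rcases le_total M s' with hc | hc
  · rw [show R = s' from max_eq_right hc, div_le_iff₀ hs'] at h4
    exact h4
  · rw [show R = M from max_eq_left hc, div_self hM.ne'] at h4
    linarith

/-- Parameter closeness of two weighted spherical Gaussians that are close in `L¹`. -/
lemma weighted_params_close (hd : 0 < d) (hs : 0 < s) (hs' : 0 < s') {w w' ω κ : ℝ} (hω : 0 < ω)
    (hw : ω ≤ w) (hw' : ω ≤ w') (hκω : κ ≤ ω / 80)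
    (hκ : ∫ y, |w * sphericalGaussianPdf m s y - w' * sphericalGaussianPdf m' s' y| ≤ κ) :
    |w - w'| / min w w' + ‖m - m'‖ / min s s' + |s - s'| / min s s' ≤ 81 * (κ / ω) := by
  have hi := integrable_sphericalGaussianPdf (m := m) hs
  have hi' := integrable_sphericalGaussianPdf (m := m') hs'
  have hκ0 : 0 ≤ κ := (integral_nonneg fun _ => abs_nonneg _).trans hκ
  have h1 : |w - w'| ≤ κ := by
    refine le_trans ?_ hκ
    refine le_trans (le_of_eq ?_) (abs_integral_le_integral_abs)
    rw [integral_sub (hi.const_mul _) (hi'.const_mul _), integral_const_mul, integral_const_mul,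
      integral_sphericalGaussianPdf hs, integral_sphericalGaussianPdf hs', mul_one, mul_one]
  have h2 : w * ∫ y, |sphericalGaussianPdf m s y - sphericalGaussianPdf m' s' y| ≤ 2 * κ := by
    have hle : ∀ y, w * |sphericalGaussianPdf m s y - sphericalGaussianPdf m' s' y| ≤
        |w * sphericalGaussianPdf m s y - w' * sphericalGaussianPdf m' s' y| +
          |w - w'| * sphericalGaussianPdf m' s' y := fun y => by
      have hp := sphericalGaussianPdf_nonneg (m := m') hs' y
      calc _ = |(w * sphericalGaussianPdf m s y - w' * sphericalGaussianPdf m' s' y) -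
            (w - w') * sphericalGaussianPdf m' s' y| := by
            rw [← abs_of_nonneg (hω.le.trans hw), ← abs_mul, abs_of_nonneg (hω.le.trans hw)]
            congr 1; ring
        _ ≤ _ := (abs_sub _ _).trans (by rw [abs_mul (w - w'), abs_of_nonneg hp])
    have hi1 := ((hi.const_mul w).sub (hi'.const_mul w')).abs
    have hi2 := hi'.const_mul |w - w'|
    rw [← integral_const_mul]
    calc _ ≤ _ := integral_mono ((hi.sub hi').abs.const_mul w) (hi1.add hi2) hle
      _ = _ := integral_add hi1 hi2
      _ ≤ κ + κ := by
        rw [integral_const_mul, integral_sphericalGaussianPdf hs', mul_one]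
        exact add_le_add hκ h1
      _ = _ := by ring
  set x := 2 * (κ / ω)
  have hx : ∫ y, |sphericalGaussianPdf m s y - sphericalGaussianPdf m' s' y| ≤ x := by
    have hI : 0 ≤ ∫ y, |sphericalGaussianPdf m s y - sphericalGaussianPdf m' s' y| :=
      integral_nonneg fun _ => abs_nonneg _
    simp only [x]
    rw [mul_div_assoc', le_div_iff₀ hω, mul_comm]
    exact (mul_le_mul_of_nonneg_right hw hI).trans h2
  have hx' : ∫ y, |sphericalGaussianPdf m' s' y - sphericalGaussianPdf m s y| ≤ x := by
    simp_rw [abs_sub_comm (sphericalGaussianPdf m' s' _)]; exact hx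
  have hx1 : x ≤ 1 / 40 := by
    simp only [x]
    rw [mul_div_assoc', div_le_iff₀ hω]; linarith
  have hmin : 0 < min s s' := lt_min hs hs'
  have a1 : |w - w'| / min w w' ≤ κ / ω := div_le_div₀ hκ0 h1 hω (le_min hw hw')
  have a2 : ‖m - m'‖ / min s s' ≤ 2 * x := by
    rw [div_le_iff₀ hmin]
    rcases min_cases s s' with h | h
    · rw [h.1, norm_sub_rev]; exact norm_mean_sub_le hs' hs hx' (by linarith)
    · rw [h.1]; exact norm_mean_sub_le hs hs' hx (by linarith)
  have a3 : |s - s'| / min s s' ≤ 38 * x := by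
    rw [div_le_iff₀ hmin]
    rcases le_total s s' with h | h
    · rw [min_eq_left h, abs_sub_comm, abs_of_nonneg (sub_nonneg.2 h)]
      exact scale_sub_le hd hs hs' h hx hx1
    · rw [min_eq_right h, abs_of_nonneg (sub_nonneg.2 h)]
      exact scale_sub_le hd hs' hs h hx' hx1
  -- Weights, means and scales contribute `1 + 4 + 76 = 81` times `κ / ω`.
  simp only [x] at a2 a3
  linarith

end Comparison

/-! ### Polyhedral cells around separated means. -/

section Cells

variable {ι : Type*} {d : ℕ} {μ : ι → EuclideanSpace ℝ (Fin d)} {σ : ι → ℝ} {T : ℝ}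

/-- The unit vector pointing from `μ i` to `μ l`. -/
noncomputable def unitDir (μ : ι → EuclideanSpace ℝ (Fin d)) (i l : ι) :
    EuclideanSpace ℝ (Fin d) :=
  ‖μ l - μ i‖⁻¹ • (μ l - μ i)

/-- The intersection over `l ≠ i` of the half-spaces around `μ i`, at distance `T * σ i / 2` in
the direction of `μ l`. -/
def cell (μ : ι → EuclideanSpace ℝ (Fin d)) (σ : ι → ℝ) (T : ℝ) (i : ι) :
    Set (EuclideanSpace ℝ (Fin d)) :=
  {x | ∀ l, l ≠ i → ⟪unitDir μ i l, x - μ i⟫ ≤ T * σ i / 2}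

/-- The points at height at least `D` above the cell of `i`. -/
def cellFar (μ : ι → EuclideanSpace ℝ (Fin d)) (σ : ι → ℝ) (T D : ℝ) (i : ι) :
    Set (EuclideanSpace ℝ (Fin d)) :=
  {x | ∃ l, l ≠ i ∧ T * σ i / 2 + D ≤ ⟪unitDir μ i l, x - μ i⟫}

lemma norm_unitDir_le (i l : ι) : ‖unitDir μ i l‖ ≤ 1 := by
  rw [unitDir, norm_smul, norm_inv, norm_norm]
  exact inv_mul_le_one

lemma norm_unitDir {i l : ι} (h : 0 < ‖μ l - μ i‖) : ‖unitDir μ i l‖ = 1 := by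
  rw [unitDir, norm_smul, norm_inv, norm_norm, inv_mul_cancel₀ h.ne']

lemma measurableSet_cell [Finite ι] (i : ι) : MeasurableSet (cell μ σ T i) := by
  simp only [cell, Set.ofPred_forall]
  exact MeasurableSet.iInter fun l => MeasurableSet.iInter fun _ =>
    measurableSet_le (by fun_prop) measurable_const

lemma measurableSet_cellFar [Finite ι] {D : ℝ} (i : ι) : MeasurableSet (cellFar μ σ T D i) := by
  have : cellFar μ σ T D i =
      ⋃ l, ⋃ (_ : l ≠ i), {x | T * σ i / 2 + D ≤ ⟪unitDir μ i l, x - μ i⟫} := by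
    ext x; simp [cellFar]
  rw [this]
  exact MeasurableSet.iUnion fun l => MeasurableSet.iUnion fun _ =>
    measurableSet_le measurable_const (by fun_prop)

lemma cell_disjoint_cellFar {D : ℝ} (hD : 0 < D) (i : ι) :
    Disjoint (cell μ σ T i) (cellFar μ σ T D i) := by
  rw [Set.disjoint_left]
  rintro x hx ⟨l, hl, h⟩
  linarith [hx l hl]

/-- In the direction from `μ i` to `μ l`, a point of the cell of `l` has height at least `T (σ i + σ
l) - T σ l / 2`. This exceeds `T σ i / 2` by at least `T (σ i + σ l) / 2 ≥ D`. -/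
lemma cell_subset_cellFar {D : ℝ} (hσ : ∀ i, 0 < σ i) (hT : 0 < T)
    (hsep : ∀ i l, i ≠ l → T * (σ i + σ l) ≤ ‖μ i - μ l‖) (hD : ∀ i, D ≤ T * σ i) {i l : ι}
    (hil : l ≠ i) : cell μ σ T l ⊆ cellFar μ σ T D i := by
  intro x hx
  refine ⟨l, hil, ?_⟩
  have h1 := hx i hil.symm
  have h2 := hsep l i hil
  have hpos : 0 < ‖μ l - μ i‖ := lt_of_lt_of_le (mul_pos hT (add_pos (hσ l) (hσ i))) h2
  have e1 : unitDir μ l i = -unitDir μ i l := by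
    rw [unitDir, unitDir, norm_sub_rev, ← smul_neg, neg_sub]
  have e2 : ⟪unitDir μ i l, x - μ i⟫ = ⟪unitDir μ i l, x - μ l⟫ + ‖μ l - μ i‖ := by
    rw [show x - μ i = (x - μ l) + (μ l - μ i) by abel, inner_add_right]
    congr 1
    rw [unitDir, real_inner_smul_left, real_inner_self_eq_norm_sq]
    field_simp
  rw [e1, inner_neg_left] at h1
  rw [e2]
  linarith [hD i, hD l]

/-- Union bound over the faces, each at distance `T * σ i / 2` from the mean. -/
lemma sphericalGaussian_compl_cell_le [Fintype ι] (hσ : ∀ i, 0 < σ i) (hT : 0 < T)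
    (hsep : ∀ i l, i ≠ l → T * (σ i + σ l) ≤ ‖μ i - μ l‖) (i : ι) :
    (sphericalGaussian (μ i) (σ i)).real (cell μ σ T i)ᶜ ≤
      Fintype.card ι * Real.exp (-(Real.pi * T ^ 2 / 4)) := by
  classical
  have := isProbabilityMeasure_sphericalGaussian (m := μ i) (hσ i)
  have hsub : (cell μ σ T i)ᶜ ⊆
      ⋃ l : {l // l ≠ i}, {x | T * σ i / 2 < ⟪unitDir μ i l, x - μ i⟫} := by
    intro x hx
    simp only [cell, Set.mem_compl_iff, Set.mem_ofPred_eq, not_forall, not_le] at hx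
    obtain ⟨l, hl, h⟩ := hx
    exact Set.mem_iUnion.2 ⟨⟨l, hl⟩, h⟩
  refine (measureReal_mono hsub).trans ((measureReal_iUnion_fintype_le _).trans ?_)
  have hb : ∀ l : {l // l ≠ i}, (sphericalGaussian (μ i) (σ i)).real
      {x | T * σ i / 2 < ⟪unitDir μ i l, x - μ i⟫} ≤ Real.exp (-(Real.pi * T ^ 2 / 4)) := by
    rintro ⟨l, hl⟩
    have hpos : 0 < ‖μ l - μ i‖ :=
      lt_of_lt_of_le (mul_pos hT (add_pos (hσ l) (hσ i))) (hsep l i hl)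
    have hi := hσ i
    refine (sphericalGaussian_halfspace_le hi (norm_unitDir hpos) (by positivity)).trans
      (le_of_eq ?_)
    congr 2
    field_simp
    ring
  refine (Finset.sum_le_sum fun l _ => hb l).trans ?_
  rw [Finset.sum_const, nsmul_eq_mul, Finset.card_univ]
  gcongr
  exact Fintype.card_subtype_le _

lemma sphericalGaussian_cell_layer [Fintype ι] [Nontrivial ι] {m : EuclideanSpace ℝ (Fin d)}
    {s D : ℝ} (hs : 0 < s) (hD : 0 < D) (i : ι) :
    D * ((sphericalGaussian m s).real (cell μ σ T i) *
        (sphericalGaussian m s).real (cellFar μ σ T D i)) ≤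
      10 * s * (sphericalGaussian m s).real (cell μ σ T i ∪ cellFar μ σ T D i)ᶜ := by
  classical
  obtain ⟨l₀, hl₀⟩ := exists_ne i
  -- The polyhedron needs a face, hence a second index.
  have : Nonempty {l // l ≠ i} := ⟨⟨l₀, hl₀⟩⟩
  have e : ∀ (l : ι) x, ⟪unitDir μ i l, x⟫ + (-⟪unitDir μ i l, μ i⟫ - T * σ i / 2) =
      ⟪unitDir μ i l, x - μ i⟫ - T * σ i / 2 := fun l x => by rw [inner_sub_right]; ring
  refine sphericalGaussian_polyhedron_layer hs (fun l : {l // l ≠ i} => unitDir μ i l)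
    (fun l => -⟪unitDir μ i l, μ i⟫ - T * σ i / 2) (fun l => norm_unitDir_le _ _) hD ?_ ?_
    ((measurableSet_cell i).union (measurableSet_cellFar i)).compl (measurableSet_cell i)
    (measurableSet_cellFar i) ?_
  · rintro x hx ⟨l, hl⟩
    rw [e]; linarith [hx l hl]
  · rintro x ⟨l, hl, h⟩
    exact ⟨⟨l, hl⟩, by rw [e]; linarith⟩
  · intro x hx
    rw [Set.notMem_compl_iff] at hx
    rcases hx with hx | ⟨l, hl, h⟩
    · exact Or.inl fun ⟨l, hl⟩ => by rw [e]; linarith [hx l hl]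
    · exact Or.inr ⟨⟨l, hl⟩, by rw [e]; linarith⟩

end Cells

/-! ### Matching the components of the two mixtures. -/

namespace SphericalMixture

variable {k d : ℕ}

lemma integrable_pdf (G : SphericalMixture k d) : Integrable G.pdf :=
  integrable_finsetSum _ fun j _ => (integrable_sphericalGaussianPdf (G.σ_pos j)).const_mul _

/-- The `j`-th component as a measure. -/
noncomputable abbrev component (G : SphericalMixture k d) (j : Fin k) :
    Measure (EuclideanSpace ℝ (Fin d)) :=
  sphericalGaussian (G.μ j) (G.σ j)

instance (G : SphericalMixture k d) (j : Fin k) : IsProbabilityMeasure (G.component j) :=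
  isProbabilityMeasure_sphericalGaussian (G.σ_pos j)

lemma setIntegral_pdf (G : SphericalMixture k d) {S : Set (EuclideanSpace ℝ (Fin d))}
    (hS : MeasurableSet S) : ∫ x in S, G.pdf x = ∑ j, G.w j * (G.component j).real S := by
  unfold pdf
  rw [integral_finsetSum _ fun j _ =>
    ((integrable_sphericalGaussianPdf (G.σ_pos j)).const_mul _).integrableOn]
  exact Finset.sum_congr rfl fun j _ => by
    rw [integral_const_mul, sphericalGaussian_real_apply (G.σ_pos j) hS]

lemma abs_sum_measure_sub_le (G G' : SphericalMixture k d) {S : Set (EuclideanSpace ℝ (Fin d))}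
    (hS : MeasurableSet S) :
    |∑ j, G.w j * (G.component j).real S - ∑ j, G'.w j * (G'.component j).real S| ≤
      ∫ x, |G.pdf x - G'.pdf x| := by
  rw [← setIntegral_pdf G hS, ← setIntegral_pdf G' hS,
    ← integral_sub G.integrable_pdf.integrableOn G'.integrable_pdf.integrableOn]
  exact abs_integral_le_integral_abs.trans (setIntegral_le_integral
    (G.integrable_pdf.sub G'.integrable_pdf).abs (ae_of_all _ fun _ => abs_nonneg _))

/-- Comparison of single components on a set and on its complement. -/
lemma integral_abs_component_sub_le (G G' : SphericalMixture k d) (i j : Fin k)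
    {S : Set (EuclideanSpace ℝ (Fin d))} (hS : MeasurableSet S) :
    ∫ x, |G.w i * sphericalGaussianPdf (G.μ i) (G.σ i) x -
        G'.w j * sphericalGaussianPdf (G'.μ j) (G'.σ j) x| ≤
      (∫ x, |G.pdf x - G'.pdf x|) +
      (∑ m ∈ Finset.univ.erase i, G.w m * (G.component m).real S +
        G.w i * (G.component i).real Sᶜ) +
      (∑ m ∈ Finset.univ.erase j, G'.w m * (G'.component m).real S +
        G'.w j * (G'.component j).real Sᶜ) := by
  set g : Fin k → EuclideanSpace ℝ (Fin d) → ℝ := fun i x =>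
    G.w i * sphericalGaussianPdf (G.μ i) (G.σ i) x
  set g' : Fin k → EuclideanSpace ℝ (Fin d) → ℝ := fun i x =>
    G'.w i * sphericalGaussianPdf (G'.μ i) (G'.σ i) x
  have ig : ∀ i, Integrable (g i) := fun i =>
    (integrable_sphericalGaussianPdf (G.σ_pos i)).const_mul _
  have ig' : ∀ i, Integrable (g' i) := fun i =>
    (integrable_sphericalGaussianPdf (G'.σ_pos i)).const_mul _
  have ng : ∀ i x, 0 ≤ g i x := fun i x =>
    mul_nonneg (G.w_nonneg i) (sphericalGaussianPdf_nonneg (G.σ_pos i) x)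
  have ng' : ∀ i x, 0 ≤ g' i x := fun i x =>
    mul_nonneg (G'.w_nonneg i) (sphericalGaussianPdf_nonneg (G'.σ_pos i) x)
  have mg : ∀ i {S}, MeasurableSet S → ∫ x in S, g i x = G.w i * (G.component i).real S :=
    fun i S hS => by rw [integral_const_mul, sphericalGaussian_real_apply (G.σ_pos i) hS]
  have mg' : ∀ i {S}, MeasurableSet S → ∫ x in S, g' i x = G'.w i * (G'.component i).real S :=
    fun i S hS => by rw [integral_const_mul, sphericalGaussian_real_apply (G'.σ_pos i) hS]
  have hf : Integrable fun x => |G.pdf x - G'.pdf x| := (G.integrable_pdf.sub G'.integrable_pdf).abs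
  have sg : Integrable fun x => ∑ m ∈ Finset.univ.erase i, g m x :=
    integrable_finsetSum _ fun m _ => ig m
  have sg' : Integrable fun x => ∑ m ∈ Finset.univ.erase j, g' m x :=
    integrable_finsetSum _ fun m _ => ig' m
  have hdiff : Integrable fun x => |g i x - g' j x| := ((ig i).sub (ig' j)).abs
  -- On `S` the two chosen components differ as the mixtures do, up to the mass of the other
  -- components.
  have hin : ∫ x in S, |g i x - g' j x| ≤ (∫ x, |G.pdf x - G'.pdf x|) +
      ∑ m ∈ Finset.univ.erase i, G.w m * (G.component m).real S +
      ∑ m ∈ Finset.univ.erase j, G'.w m * (G'.component m).real S := by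
    calc ∫ x in S, |g i x - g' j x|
        ≤ ∫ x in S, (|G.pdf x - G'.pdf x| + ∑ m ∈ Finset.univ.erase i, g m x +
            ∑ m ∈ Finset.univ.erase j, g' m x) := by
          refine setIntegral_mono hdiff.integrableOn ((hf.add sg).add sg').integrableOn fun x => ?_
          have e : G.pdf x = g i x + ∑ m ∈ Finset.univ.erase i, g m x :=
            (Finset.add_sum_erase _ _ (Finset.mem_univ i)).symm
          have e' : G'.pdf x = g' j x + ∑ m ∈ Finset.univ.erase j, g' m x :=
            (Finset.add_sum_erase _ _ (Finset.mem_univ j)).symm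
          have n1 : 0 ≤ ∑ m ∈ Finset.univ.erase i, g m x := Finset.sum_nonneg fun m _ => ng m x
          have n2 : 0 ≤ ∑ m ∈ Finset.univ.erase j, g' m x := Finset.sum_nonneg fun m _ => ng' m x
          simp only
          rw [abs_le]
          have h1 := le_abs_self (G.pdf x - G'.pdf x)
          have h2 := neg_abs_le (G.pdf x - G'.pdf x)
          constructor <;> linarith
      _ = (∫ x in S, |G.pdf x - G'.pdf x|) +
          ∑ m ∈ Finset.univ.erase i, G.w m * (G.component m).real S +
          ∑ m ∈ Finset.univ.erase j, G'.w m * (G'.component m).real S := by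
          rw [integral_add (f := fun x => |G.pdf x - G'.pdf x| + ∑ m ∈ Finset.univ.erase i, g m x)
              (hf.add sg).integrableOn sg'.integrableOn,
            integral_add hf.integrableOn sg.integrableOn,
            integral_finsetSum _ fun m _ => (ig m).integrableOn,
            integral_finsetSum _ fun m _ => (ig' m).integrableOn]
          simp_rw [mg _ hS, mg' _ hS]
      _ ≤ _ := by
          have := setIntegral_le_integral (s := S) hf (ae_of_all _ fun _ => abs_nonneg _)
          linarith
  have hout : ∫ x in Sᶜ, |g i x - g' j x| ≤ G.w i * (G.component i).real Sᶜ +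
      G'.w j * (G'.component j).real Sᶜ := by
    rw [← mg _ hS.compl, ← mg' _ hS.compl,
      ← integral_add (ig i).integrableOn (ig' j).integrableOn]
    refine setIntegral_mono hdiff.integrableOn ((ig i).add (ig' j)).integrableOn fun x => ?_
    have h1 := ng i x
    have h2 := ng' j x
    simp only
    rw [abs_le]
    constructor <;> linarith
  rw [← integral_add_compl hS hdiff]
  linarith

/-- If `G` is well separated and `G'` is close to it in `L¹`, then the components can be matched
so that matched weighted components are close in `L¹`. -/
theorem exists_perm_components_close (G G' : SphericalMixture k d) (hk : 2 ≤ k)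
    {ρ T τ ω ε s₀ : ℝ} (hs₀ : 0 < s₀) (hσ : ∀ i, s₀ ≤ G.σ i) (hσ' : ∀ j, G'.σ j ≤ ρ * s₀)
    (hρ : 1 ≤ ρ) (hT : 1 ≤ T)
    (hsep : ∀ i l, i ≠ l → T * (G.σ i + G.σ l) ≤ ‖G.μ i - G.μ l‖)
    (hτ : Real.exp (-(Real.pi * T ^ 2 / 4)) ≤ τ) (hw : ∀ i, ω ≤ G.w i) (hω : 0 < ω)
    (hε : ∫ x, |G.pdf x - G'.pdf x| ≤ ε) (hsmall : 100 * (ρ * (ε + k * τ)) ≤ ω) :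
    ∃ π : Equiv.Perm (Fin k), ∀ i,
      ∫ x, |G.w i * sphericalGaussianPdf (G.μ i) (G.σ i) x -
        G'.w (π i) * sphericalGaussianPdf (G'.μ (π i)) (G'.σ (π i)) x| ≤
      24 * (ρ * (ε + k * τ)) := by
  have : Nontrivial (Fin k) := Fin.nontrivial_iff_two_le.2 hk
  have hT0 : 0 < T := by linarith
  set Λ := ρ * (ε + k * τ) with hΛ
  have hε0 : 0 ≤ ε := (integral_nonneg fun _ => abs_nonneg _).trans hε
  have hτ0 : 0 ≤ τ := (Real.exp_pos _).le.trans hτ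
  have hkτ : 0 ≤ k * τ := by positivity
  have hΛ1 : ε + k * τ ≤ Λ := le_mul_of_one_le_left (by positivity) hρ
  -- Small enough that all other cells lie beyond the layer, yet `G'.σ j ≤ ρ * D`, so isoperimetry
  -- loses only a factor `ρ`.
  set D := T * s₀ with hDdef
  have hD : 0 < D := by positivity
  set A : Fin k → Set (EuclideanSpace ℝ (Fin d)) := cell G.μ G.σ T
  set B : Fin k → Set (EuclideanSpace ℝ (Fin d)) := cellFar G.μ G.σ T D
  have mA : ∀ i, MeasurableSet (A i) := measurableSet_cell
  have mB : ∀ i, MeasurableSet (B i) := measurableSet_cellFar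
  have hAB : ∀ i, Disjoint (A i) (B i) := cell_disjoint_cellFar hD
  have hsub : ∀ i l, l ≠ i → A l ⊆ B i := fun i l h =>
    cell_subset_cellFar G.σ_pos hT0 hsep (fun i => mul_le_mul_of_nonneg_left (hσ i) hT0.le) h
  have hAA : ∀ i l, l ≠ i → Disjoint (A i) (A l) := fun i l h => (hAB i).mono_right (hsub i l h)
  have hP : ∀ i, (G.component i).real (A i)ᶜ ≤ k * τ := fun i => by
    refine (sphericalGaussian_compl_cell_le G.σ_pos hT0 hsep i).trans ?_
    rw [Fintype.card_fin]
    gcongr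
  -- The layer misses every cell, so each component of `G` gives it mass at most `k * τ`.
  have hCsub : ∀ i m, (A i ∪ B i)ᶜ ⊆ (A m)ᶜ := fun i m => by
    rw [Set.compl_subset_compl]
    rcases eq_or_ne m i with rfl | h
    · exact Set.subset_union_left
    · exact (hsub i m h).trans Set.subset_union_right
  have wle : ∀ (q : Fin k → ℝ) {c : ℝ}, (∀ m, q m ≤ c) → ∑ m, G.w m * q m ≤ c := by
    intro q c h
    calc ∑ m, G.w m * q m ≤ ∑ m, G.w m * c :=
          Finset.sum_le_sum fun m _ => mul_le_mul_of_nonneg_left (h m) (G.w_nonneg m)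
      _ = c := by rw [← Finset.sum_mul, G.w_sum, one_mul]
  have hC : ∀ i, ∑ j, G'.w j * (G'.component j).real (A i ∪ B i)ᶜ ≤ ε + k * τ := fun i => by
    have h1 := abs_le.1 (abs_sum_measure_sub_le G G' ((mA i).union (mB i)).compl)
    have h2 := wle (fun m => (G.component m).real (A i ∪ B i)ᶜ)
      (fun m => (measureReal_mono (hCsub i m)).trans (hP m))
    linarith [h1.1]
  -- `1 - Q(A)` is the far mass plus the layer mass: isoperimetry contributes `10 * ρ`, and the
  -- trivial bound on the layer term contributes the last `ρ`.
  have hiso : ∀ i j, (G'.component j).real (A i) * (1 - (G'.component j).real (A i)) ≤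
      11 * ρ * (G'.component j).real (A i ∪ B i)ᶜ := by
    intro i j
    set Q := G'.component j
    have h1 : D * (Q.real (A i) * Q.real (B i)) ≤ 10 * G'.σ j * Q.real (A i ∪ B i)ᶜ :=
      sphericalGaussian_cell_layer (G'.σ_pos j) hD i
    have h2 : 10 * G'.σ j ≤ D * (10 * ρ) := by
      have := hσ' j
      have h3 : ρ * s₀ ≤ T * (ρ * s₀) := le_mul_of_one_le_left (by positivity) hT
      rw [hDdef]; nlinarith
    have hq : 0 ≤ Q.real (A i ∪ B i)ᶜ := measureReal_nonneg
    have h3 : Q.real (A i) * Q.real (B i) ≤ 10 * ρ * Q.real (A i ∪ B i)ᶜ := by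
      refine le_of_mul_le_mul_left (h1.trans ?_) hD
      rw [← mul_assoc D]
      exact mul_le_mul_of_nonneg_right h2 hq
    have h4 : Q.real (A i ∪ B i)ᶜ = 1 - (Q.real (A i) + Q.real (B i)) := by
      rw [probReal_compl_eq_one_sub ((mA i).union (mB i)), measureReal_union (hAB i) (mB i)]
    have h5 : Q.real (A i) ≤ 1 := measureReal_le_one
    have h6 : 0 ≤ Q.real (A i) := measureReal_nonneg
    have h7 : Q.real (A i) * Q.real (A i ∪ B i)ᶜ ≤ ρ * Q.real (A i ∪ B i)ᶜ :=
      mul_le_mul_of_nonneg_right (h5.trans hρ) hq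
    have h8 : 1 - Q.real (A i) = Q.real (B i) + Q.real (A i ∪ B i)ᶜ := by linarith
    rw [h8]
    linarith
  have hη : ∀ i, ∑ j, G'.w j * ((G'.component j).real (A i) *
      (1 - (G'.component j).real (A i))) ≤ 11 * Λ := fun i => by
    calc _ ≤ ∑ j, G'.w j * (11 * ρ * (G'.component j).real (A i ∪ B i)ᶜ) :=
          Finset.sum_le_sum fun j _ => mul_le_mul_of_nonneg_left (hiso i j) (G'.w_nonneg j)
      _ = 11 * ρ * ∑ j, G'.w j * (G'.component j).real (A i ∪ B i)ᶜ := by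
          rw [Finset.mul_sum]; exact Finset.sum_congr rfl fun j _ => by ring
      _ ≤ 11 * ρ * (ε + k * τ) := mul_le_mul_of_nonneg_left (hC i) (by positivity)
      _ = _ := by rw [hΛ]; ring
  have q0 : ∀ i j, 0 ≤ (G'.component j).real (A i) := fun i j => measureReal_nonneg
  have q1 : ∀ i j, (G'.component j).real (A i) ≤ 1 := fun i j => measureReal_le_one
  have hex : ∀ i, ∃ j, 1 / 2 < (G'.component j).real (A i) := by
    intro i
    -- If every `q ≤ 1 / 2`, then `q ≤ 2 q (1 - q)` and `G'` gives the cell at most `22 * Λ`,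
    -- whereas `G` gives it nearly `G.w i ≥ 100 * Λ`.
    by_contra! hcon
    have h1 : ∑ j, G'.w j * (G'.component j).real (A i) ≤ 22 * Λ := by
      calc _ ≤ ∑ j, 2 * (G'.w j * ((G'.component j).real (A i) *
            (1 - (G'.component j).real (A i)))) := Finset.sum_le_sum fun j _ => by
            have := mul_nonneg (G'.w_nonneg j) (mul_nonneg (q0 i j)
              (by linarith [hcon j] : 0 ≤ 1 - 2 * (G'.component j).real (A i)))
            linarith
        _ ≤ _ := by rw [← Finset.mul_sum]; linarith [hη i]
    have h2 := (abs_le.1 (abs_sum_measure_sub_le G G' (mA i))).2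
    have h3 : G.w i * (G.component i).real (A i) ≤ ∑ j, G.w j * (G.component j).real (A i) :=
      Finset.single_le_sum (f := fun j => G.w j * (G.component j).real (A i))
        (fun j _ => mul_nonneg (G.w_nonneg j) measureReal_nonneg) (Finset.mem_univ i)
    have h4 : 1 - k * τ ≤ (G.component i).real (A i) := by
      have := hP i
      rw [probReal_compl_eq_one_sub (mA i)] at this
      linarith
    have h5 : G.w i ≤ 1 := by
      rw [← G.w_sum]
      exact Finset.single_le_sum (fun j _ => G.w_nonneg j) (Finset.mem_univ i)
    have h6 := mul_le_mul_of_nonneg_left h4 (G.w_nonneg i)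
    have h7 : G.w i * (k * τ) ≤ k * τ := mul_le_of_le_one_left hkτ h5
    linarith [hw i]
  choose f hf using hex
  -- No component has more than half its mass in each of two disjoint cells.
  have hinj : Function.Injective f := by
    intro i l hil
    by_contra hne
    have h1 := hf i
    have h2 := hf l
    rw [← hil] at h2
    have h3 : (G'.component (f i)).real (A i ∪ A l) ≤ 1 := measureReal_le_one
    rw [measureReal_union (hAA i l (Ne.symm hne)) (mA l)] at h3
    linarith
  refine ⟨Equiv.ofBijective f (Finite.injective_iff_bijective.1 hinj), fun i => ?_⟩
  rw [Equiv.ofBijective_apply]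
  refine (integral_abs_component_sub_le G G' i (f i) (mA i)).trans ?_
  have h1 : ∑ m ∈ Finset.univ.erase i, G.w m * (G.component m).real (A i) +
      G.w i * (G.component i).real (A i)ᶜ ≤ k * τ := by
    refine le_trans ?_ (wle (fun m => (G.component m).real (A m)ᶜ) hP)
    rw [← Finset.sum_erase_add _ _ (Finset.mem_univ i)]
    refine add_le_add_left (Finset.sum_le_sum fun m hm => ?_) _
    exact mul_le_mul_of_nonneg_left
      (measureReal_mono (hAA i m (Finset.ne_of_mem_erase hm)).subset_compl_right) (G.w_nonneg m)
  -- By surjectivity `j = f l`, and more than half of this component already lies in the disjoint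
  -- cell of `l`.
  have hlow : ∀ j, j ≠ f i → (G'.component j).real (A i) ≤ 1 / 2 := by
    intro j hj
    obtain ⟨l, rfl⟩ := Finite.injective_iff_surjective.1 hinj j
    have hne : l ≠ i := fun h => hj (by rw [h])
    have h2 := hf l
    have h3 : (G'.component (f l)).real (A i ∪ A l) ≤ 1 := measureReal_le_one
    rw [measureReal_union (hAA i l hne) (mA l)] at h3
    linarith
  have h2 : ∑ m ∈ Finset.univ.erase (f i), G'.w m * (G'.component m).real (A i) +
      G'.w (f i) * (G'.component (f i)).real (A i)ᶜ ≤ 22 * Λ := by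
    -- The misplaced mass is `q` for the unmatched components, where `q ≤ 1 / 2`, and `1 - q` for
    -- the matched one, where `q > 1 / 2`; each is at most `2 q (1 - q)`.
    calc _ ≤ ∑ j, 2 * (G'.w j * ((G'.component j).real (A i) *
          (1 - (G'.component j).real (A i)))) := by
          rw [← Finset.sum_erase_add _ _ (Finset.mem_univ (f i))]
          refine add_le_add (Finset.sum_le_sum fun j hj => ?_) ?_
          · have := mul_nonneg (G'.w_nonneg j) (mul_nonneg (q0 i j)
              (by linarith [hlow j (Finset.ne_of_mem_erase hj)] :
                0 ≤ 1 - 2 * (G'.component j).real (A i)))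
            linarith
          · rw [probReal_compl_eq_one_sub (mA i)]
            have := mul_nonneg (G'.w_nonneg (f i)) (mul_nonneg
              (by linarith [q1 i (f i)] : 0 ≤ 1 - (G'.component (f i)).real (A i))
              (by linarith [hf i] : 0 ≤ 2 * (G'.component (f i)).real (A i) - 1))
            linarith
      _ ≤ _ := by rw [← Finset.mul_sum]; linarith [hη i]
  linarith

end SphericalMixture

/-! ### Bounds on the mixture parameters, and the conclusion. -/

namespace SphericalMixture

variable {k d : ℕ}

lemma nonempty_index (G : SphericalMixture k d) : Nonempty (Fin k) := by
  by_contra h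
  rw [not_nonempty_iff] at h
  have := G.w_sum
  simp at this

lemma wMin_le (G : SphericalMixture k d) (i : Fin k) : G.wMin ≤ G.w i :=
  ciInf_le (Set.finite_range _).bddBelow i

lemma σMin_le (G : SphericalMixture k d) (i : Fin k) : G.σMin ≤ G.σ i :=
  ciInf_le (Set.finite_range _).bddBelow i

lemma le_σMax (G : SphericalMixture k d) (i : Fin k) : G.σ i ≤ G.σMax :=
  le_ciSup (Set.finite_range _).bddAbove i

lemma σMin_pos (G : SphericalMixture k d) : 0 < G.σMin := by
  have := G.nonempty_index
  obtain ⟨i, hi⟩ := exists_eq_ciInf_of_finite (f := G.σ)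
  rw [σMin, ← hi]
  exact G.σ_pos i

lemma wMin_mul_le_one (G : SphericalMixture k d) : k * G.wMin ≤ 1 := by
  calc (k : ℝ) * G.wMin = ∑ _i : Fin k, G.wMin := by simp
    _ ≤ ∑ i, G.w i := Finset.sum_le_sum fun i _ => G.wMin_le i
    _ = 1 := G.w_sum

lemma σ_le_aspectRatio_mul (G G' : SphericalMixture k d) (j : Fin k) :
    G'.σ j ≤ G.aspectRatio G' * G.σMin := by
  refine (G'.le_σMax j).trans ?_
  rw [← div_le_iff₀ G.σMin_pos]
  exact le_max_left _ _

lemma one_le_aspectRatio (G G' : SphericalMixture k d) : 1 ≤ G.aspectRatio G' := by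
  obtain ⟨i⟩ := G.nonempty_index
  rcases le_total (G'.σ i) (G.σ i) with h | h
  · refine le_trans ?_ (le_max_right _ _)
    rw [one_le_div G'.σMin_pos]
    exact (G'.σMin_le i).trans (h.trans (G.le_σMax i))
  · refine le_trans ?_ (le_max_left _ _)
    rw [one_le_div G.σMin_pos]
    exact (G.σMin_le i).trans (h.trans (G'.le_σMax i))

lemma paramDist_le (hd : 0 < d) (G G' : SphericalMixture k d) (π : Equiv.Perm (Fin k))
    {ω κ : ℝ} (hω : 0 < ω) (hw : ∀ i, ω ≤ G.w i) (hw' : ∀ i, ω ≤ G'.w i) (hκω : κ ≤ ω / 80)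
    (hκ : ∀ i, ∫ x, |G.w i * sphericalGaussianPdf (G.μ i) (G.σ i) x -
        G'.w (π i) * sphericalGaussianPdf (G'.μ (π i)) (G'.σ (π i)) x| ≤ κ) :
    G.paramDist G' ≤ k * (81 * (κ / ω)) := by
  refine (Finset.inf'_le _ (Finset.mem_univ π)).trans ?_
  rw [← Finset.sum_add_distrib, ← Finset.sum_add_distrib]
  calc _ ≤ ∑ _i : Fin k, 81 * (κ / ω) := Finset.sum_le_sum fun i _ =>
        weighted_params_close hd (G.σ_pos i) (G'.σ_pos _) hω (hw i) (hw' _) hκω (hκ i)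
    _ = _ := by simp

end SphericalMixture

/-- The Gaussian tail at the separation scale is negligible. -/
lemma separation_tail_le {k : ℕ} (hk : 2 ≤ k) {c ρ w : ℝ} (hc : 5 ≤ c) (hρ : 1 ≤ ρ) (hw : 0 < w)
    (hkw : k * w ≤ 1) :
    1 ≤ 4 * c * √(Real.log (ρ / w)) ∧
    ρ * (k * Real.exp (-(Real.pi * (4 * c * √(Real.log (ρ / w))) ^ 2 / 4))) ≤
      1 / 10000 * (1 / (k : ℝ) ^ (2 * c)) := by
  have hk' : (2 : ℝ) ≤ k := by exact_mod_cast hk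
  have hk0 : (0 : ℝ) < k := by linarith
  set L := Real.log (ρ / w)
  have hρ0 : 0 < ρ := by linarith
  have hexp : Real.exp L = ρ / w := Real.exp_log (by positivity)
  have hkL : (k : ℝ) ≤ Real.exp L := by
    rw [hexp, le_div_iff₀ hw]; linarith
  have hρL : ρ ≤ Real.exp L := by
    rw [hexp, le_div_iff₀ hw]
    have : w ≤ 1 := by nlinarith
    nlinarith
  have hlogk : Real.log k ≤ L := (Real.log_le_iff_le_exp hk0).2 hkL
  have hL : 0.69 ≤ L := by
    have := Real.log_le_log (by norm_num) hk'
    linarith [Real.log_two_gt_d9]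
  have hsqrt : 1 / 2 ≤ √L := Real.le_sqrt_of_sq_le (by linarith)
  refine ⟨by nlinarith, ?_⟩
  have e1 : (4 * c * √L) ^ 2 = 16 * c ^ 2 * L := by
    rw [mul_pow, Real.sq_sqrt (by linarith)]; ring
  -- The exponent equals `4 π c² L`, and `π c ≥ 15`.
  have h1 : 60 * c * L ≤ Real.pi * (4 * c * √L) ^ 2 / 4 := by
    rw [e1]
    have h2 : 60 * c ≤ Real.pi * (4 * c ^ 2) := by nlinarith [Real.pi_gt_three]
    calc 60 * c * L ≤ Real.pi * (4 * c ^ 2) * L :=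
          mul_le_mul_of_nonneg_right h2 (by linarith)
      _ = _ := by ring
  have h2 : Real.exp (-(Real.pi * (4 * c * √L) ^ 2 / 4)) ≤ Real.exp (-(60 * c * L)) :=
    Real.exp_le_exp.2 (neg_le_neg h1)
  -- Of the exponent `60 c L`, the part `2 c L` pays for `k ^ (-2c)` and `2 L` for the factors `ρ`
  -- and `k`; the rest yields the constant.
  have h3 : Real.exp (-((58 * c - 2) * L)) ≤ 1 / 10000 := by
    rw [Real.exp_neg, ← one_div]
    apply one_div_le_one_div_of_le (by norm_num)
    have h4 : 180 ≤ (58 * c - 2) * L := by nlinarith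
    have h5 := Real.quadratic_le_exp_of_nonneg (x := (58 * c - 2) * L) (by linarith)
    nlinarith
  have h4 : Real.exp (-(2 * c * L)) ≤ 1 / (k : ℝ) ^ (2 * c) := by
    rw [Real.exp_neg, ← one_div, Real.rpow_def_of_pos hk0]
    apply one_div_le_one_div_of_le (Real.exp_pos _)
    rw [Real.exp_le_exp, mul_comm]
    exact mul_le_mul_of_nonneg_left hlogk (by linarith)
  calc _ ≤ Real.exp L * (Real.exp L * Real.exp (-(60 * c * L))) := by gcongr
    _ = Real.exp (-((58 * c - 2) * L)) * Real.exp (-(2 * c * L)) := by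
        rw [← Real.exp_add, ← Real.exp_add, ← Real.exp_add]; congr 1; ring
    _ ≤ _ := by gcongr

theorem proposition5p3 :
    ∃ c' : ℝ, 0 < c' ∧
      ∀ (d k : ℕ) (_ : 0 < d) (c : ℝ) (_ : 5 ≤ c) (G G' : SphericalMixture k d),
        1 / (k : ℝ) ^ (c - 1) ≤ G.paramDist G' →
        (∀ i j : Fin k, i ≠ j →
          4 * c * Real.sqrt (Real.log (G.aspectRatio G' / G.wMin)) * (G.σ i + G.σ j)
            ≤ ‖G.μ i - G.μ j‖) →
        1 / (k : ℝ) ^ c ≤ G.wMin →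
        1 / (k : ℝ) ^ c ≤ G'.wMin →
        c' / (d * (k : ℝ) ^ (2 * c) * G.aspectRatio G' ^ 2)
          ≤ ∫ x : EuclideanSpace ℝ (Fin d), |G.pdf x - G'.pdf x| := by
  refine ⟨1 / 10000, by norm_num, fun d k hd c hc G G' hpar hsep hw hw' => ?_⟩
  by_contra! hlt
  set ρ := G.aspectRatio G' with hρdef
  have hρ : 1 ≤ ρ := G.one_le_aspectRatio G'
  have hd1 : (1 : ℝ) ≤ d := by exact_mod_cast hd
  obtain ⟨i₀⟩ := G.nonempty_index
  have hk1 : (1 : ℝ) ≤ k := by exact_mod_cast i₀.pos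
  have hk0 : (0 : ℝ) < k := by linarith
  set ω := 1 / (k : ℝ) ^ c with hω
  have hω0 : 0 < ω := by positivity
  have hω1 : ω ≤ 1 := (div_le_one (by positivity)).2 (Real.one_le_rpow hk1 (by linarith))
  have hω2 : 1 / (k : ℝ) ^ (2 * c) = ω ^ 2 := by
    rw [hω, div_pow, one_pow, ← Real.rpow_mul_natCast hk0.le]; ring_nf
  have hkω : 1 / (k : ℝ) ^ (c - 1) = k * ω := by
    rw [hω, Real.rpow_sub_one hk0.ne']; field_simp
  -- One factor `ρ` and the factor `d` of the denominator are simply discarded.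
  have hε : ρ * ∫ x, |G.pdf x - G'.pdf x| ≤ 1 / 10000 * ω ^ 2 := by
    have h1 : (1 / 10000 : ℝ) / (d * (k : ℝ) ^ (2 * c) * ρ ^ 2) ≤
        1 / 10000 / (1 * (k : ℝ) ^ (2 * c) * ρ) := by
      gcongr
      nlinarith
    calc _ ≤ ρ * (1 / 10000 / (1 * (k : ℝ) ^ (2 * c) * ρ)) :=
          mul_le_mul_of_nonneg_left (hlt.le.trans h1) (by linarith)
      _ = 1 / 10000 * (1 / (k : ℝ) ^ (2 * c)) := by field_simp
      _ = _ := by rw [hω2]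
  have hwi : ∀ i, ω ≤ G.w i := fun i => hw.trans (G.wMin_le i)
  have hwi' : ∀ i, ω ≤ G'.w i := fun i => hw'.trans (G'.wMin_le i)
  obtain ⟨π, hπ⟩ : ∃ π : Equiv.Perm (Fin k), ∀ i,
      ∫ x, |G.w i * sphericalGaussianPdf (G.μ i) (G.σ i) x -
        G'.w (π i) * sphericalGaussianPdf (G'.μ (π i)) (G'.σ (π i)) x| ≤ 48 / 10000 * ω ^ 2 := by
    -- For `k = 1` there are no faces, but the mixtures are their own single components.
    rcases (Nat.one_le_iff_ne_zero.2 i₀.pos.ne').eq_or_lt with hk | hk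
    · subst hk
      refine ⟨Equiv.refl _, fun i => ?_⟩
      have h1 : ∀ (H : SphericalMixture 1 d) x,
          H.w i * sphericalGaussianPdf (H.μ i) (H.σ i) x = H.pdf x := fun H x => by
        rw [SphericalMixture.pdf, Fin.sum_univ_one, Subsingleton.elim i 0]
      simp_rw [Equiv.refl_apply, h1]
      have h2 : 0 ≤ ∫ x, |G.pdf x - G'.pdf x| := integral_nonneg fun _ => abs_nonneg _
      nlinarith
    · obtain ⟨hT, htail⟩ := separation_tail_le hk hc hρ (hω0.trans_le hw) G.wMin_mul_le_one
      rw [hω2] at htail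
      set T := 4 * c * √(Real.log (ρ / G.wMin))
      set τ := Real.exp (-(Real.pi * T ^ 2 / 4))
      have hΛ : ρ * ((∫ x, |G.pdf x - G'.pdf x|) + k * τ) ≤ 2 / 10000 * ω ^ 2 := by
        rw [mul_add]; linarith
      obtain ⟨π, hπ⟩ := G.exists_perm_components_close G' hk G.σMin_pos G.σMin_le
        (G.σ_le_aspectRatio_mul G') hρ hT hsep le_rfl hwi hω0 le_rfl
        (by nlinarith)
      exact ⟨π, fun i => (hπ i).trans (by linarith)⟩
  have h := G.paramDist_le hd G' π hω0 hwi hwi' (by nlinarith) hπ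
  -- Since `81 * 48 / 10000 < 1`, the parameter distance falls below `k * ω`, a contradiction.
  have e : (48 / 10000 * ω ^ 2) / ω = 48 / 10000 * ω := by field_simp
  rw [e] at h
  rw [hkω] at hpar
  have hkω0 : 0 < k * ω := by positivity
  linarith
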